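/- **Conventions.** Let $\mathfrak r$ be a finite index set with $|\mathfrak r|=r$. Given vertex sets $V=(V_i)_{i\in\mathfrak r}$ and $I\subset\mathfrak r$, an *index-$I$ edge* over $V$ is a choice of exactly one vertex from $V_i$ for each $i\in I$; write $V_I$ for the set of these edges. For $k\ge 1$ and $\vec b=(b_i)_{1\le i\le k}$, a *$k$-bounded $\vec b$-colored ($\mathfrak r$-partite) hypergraph* $H$ on $V$ consists of, for each $I\subset\mathfrak r$ with $1\le |I|\le k$, a set $C_I(H)$ of exactly $b_{|I|}$ colors and a map $V_I\to C_I(H)$, $e\mapsto H(e)$. A *$k$-uniform $d$-colored hypergraph* is a $k$-bounded $(1,\dots,1,d)$-colored hypergraph in which at most one color of each index of size $k$ is called *invisible* (it counts among the $d$ colors), and the unique color of each index of size less than $k$ is invisible. It is *$h$-vertex* if each of its vertex sets has exactly $h$ elements. $\mathbb V(F)$ denotes the set of visible edges of $F$, i.e. edges whose color is not invisible. Let $\mathbf\Omega=(\mathbf\Omega_i)_{i\in\mathfrak r}$ be finite probability spaces in which every subset is measurable. A random edge $\mathbf e\in\mathbf\Omega_I$ has independent vertices, the $i$-th distributed as in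 $\mathbf\Omega_i$. A random $\phi\in\Phi(h)$ is a random partitionwise map from the vertex sets $(W_i)_{i\in\mathfrak r}$ of $F$ (with $|W_i|=h$) to $\mathbf\Omega$: every $w\in W_i$ is mapped, independently of all others, to a random point of $\mathbf\Omega_i$. For an edge $e$ of $F$, $\phi(e)$ is the edge formed by the images of its vertices. **Theorem (The Removal Lemma).** For any integers $r\ge k\ge 1$ and $h\ge 0$, any nonnegative integers $\vec b=(b_i)_{1\le i\le k}$ and any $\epsilon>0$ there is a constant $c=c(r,k,h,\vec b,\epsilon)>0$ with the following property. Let $\mathfrak r$ and $\mathbf\Omega$ be as above, let $\mathbf G$ be a $k$-bounded $\vec b$-colored $\mathfrak r$-partite hypergraph on $\mathbf\Omega$, and let $F$ be an $h$-vertex $k$-uniform $(b_k-1)$-colored $\mathfrak r$-partite hypergraph whose visible colors of each index $I$ are identified, through an arbitrary injection, with colors in $C_I(\mathbf G)$. Then at least one of the following holds. (i) There is a $k$-bounded $\vec b$-colored hypergraph $\mathbf G'$ on $\mathbf\Omega$, with the same color sets as $\mathbf G$, such that $$\mathbb P_{\mathbf e\in\mathbf\Omega_I}[\mathbf G'(\mathbf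 e)\ne\mathbf G(\mathbf e)]\le\epsilon\quad\text{for all } I\subset\mathfrak r \text{ with } |I|=k,$$ $$\text{and}\quad \mathbb P_{\phi\in\Phi(h)}[\mathbf G'(\phi(e))=F(e)\ \text{for all } e\in\mathbb V(F)]=0.$$ (ii) $\mathbb P_{\phi\in\Phi(h)}[\mathbf G(\phi(e))=F(e)\ \text{for all } e\in\mathbb V(F)]\ge c.$ -/

import Mathlib

open MeasureTheory

namespace PartiteHypergraph

/-- The nonempty sets of at most `k` indices. -/
abbrev Index (ι : Type*) (k : ℕ) : Type _ :=
  {I : Finset ι // 1 ≤ I.card ∧ I.card ≤ k}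

/-- An index-`I` edge over the vertex sets `(V i)`: a choice of exactly one vertex from `V i`
for every `i ∈ I`. -/
abbrev Edge {ι : Type*} (V : ι → Type*) (I : Finset ι) : Type _ :=
  ∀ i : {i // i ∈ I}, V i

/-- A `k`-bounded colored `ι`-partite hypergraph with vertex sets `(V i)` and with `C I` as the
set of colors of index `I`: every edge of every index `I` with `1 ≤ |I| ≤ k` gets a color. -/
structure ColoredHypergraph {ι : Type*} (k : ℕ) (V : ι → Type*) (C : Index ι k → Type*) where
  color : ∀ I : Index ι k, Edge V I.1 → C I

/-- The color sets `(C I)` are those of a `(b 1, …, b k)`-colored hypergraph: there are exactly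
`b |I|` colors of index `I`. -/
def IsColorCount {ι : Type*} {k : ℕ} (b : ℕ → ℕ) (C : Index ι k → Type*)
    [∀ I, Fintype (C I)] : Prop :=
  ∀ I : Index ι k, Fintype.card (C I) = b I.1.card

/-- A `k`-uniform `d`-colored `ι`-partite hypergraph: there are exactly `d` colors of each index
of size `k`, at most one of which is called invisible, and only one color, which is invisible, of
each index of size less than `k`. -/
structure UniformHypergraph {ι : Type*} (k d : ℕ) (W : ι → Type*) (D : Index ι k → Type*)
    [∀ I, Fintype (D I)] extends ColoredHypergraph k W D where
  invisible : ∀ I : Index ι k, Set (D I)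
  colorCount : IsColorCount (fun i => if i < k then 1 else d) D
  invisible_of_lt : ∀ I : Index ι k, I.1.card < k → invisible I = Set.univ
  invisible_of_eq : ∀ I : Index ι k, I.1.card = k → (invisible I).Subsingleton

/-- The visible colors of index `I`. -/
abbrev UniformHypergraph.VisibleColor {ι : Type*} {k d : ℕ} {W : ι → Type*}
    {D : Index ι k → Type*} [∀ I, Fintype (D I)] (F : UniformHypergraph k d W D)
    (I : Index ι k) : Type _ :=
  {a : D I // a ∉ F.invisible I}

/-- Partitionwise maps: families of maps `W i → Ω i`. -/
abbrev PartitionwiseMap {ι : Type*} (W Ω : ι → Type*) : Type _ :=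
  ∀ i, W i → Ω i

/-- The image `φ(e)` of an edge. -/
def mapEdge {ι : Type*} {W Ω : ι → Type*} (φ : PartitionwiseMap W Ω) {I : Finset ι}
    (e : Edge W I) : Edge Ω I :=
  fun i => φ i (e i)

/-- The law of a random edge of index `I`: its vertices are chosen independently, the one in
`Ω i` according to `μ i`. -/
noncomputable def edgeLaw {ι : Type*} {Ω : ι → Type*} [∀ i, MeasurableSpace (Ω i)]
    (μ : ∀ i, Measure (Ω i)) (I : Finset ι) : Measure (Edge Ω I) :=
  Measure.pi fun i : {i // i ∈ I} => μ i

/-- The law of a random partitionwise map: all vertices are mapped independently, each `w ∈ W i`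
to a point of `Ω i` chosen according to `μ i`. -/
noncomputable def mapLaw {ι : Type*} [Fintype ι] {Ω : ι → Type*} [∀ i, MeasurableSpace (Ω i)]
    (μ : ∀ i, Measure (Ω i)) (W : ι → Type*) [∀ i, Fintype (W i)] :
    Measure (PartitionwiseMap W Ω) :=
  Measure.pi fun i => Measure.pi fun _ : W i => μ i

/-- The event that `φ` is a copy of `F` in `G`, that is `G(φ(e)) = F(e)` for every visible edge `e`
of `F`. The visible colors of `F` are identified with colors of `G` through the injections `σ`. -/
def copies {ι : Type*} {k d : ℕ} {W Ω : ι → Type*} {C D : Index ι k → Type*}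
    [∀ I, Fintype (D I)] (F : UniformHypergraph k d W D)
    (σ : ∀ I, F.VisibleColor I ↪ C I) (G : ColoredHypergraph k Ω C) :
    Set (PartitionwiseMap W Ω) :=
  {φ | ∀ (I : Index ι k) (e : Edge W I.1) (he : F.color I e ∉ F.invisible I),
    G.color I (mapEdge φ e) = σ I ⟨F.color I e, he⟩}

end PartiteHypergraph

/-!
The removal lemma follows from a finitary version of the Aldous–Hoover representation.

The colors of index `I` with `|I| < k` play no role, and several pattern vertices in the same part
may be treated as separate coordinates. So let `x` be a random point of a finite product of
probability spaces, with one coordinate for each vertex of the pattern, and for each set `e` of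
coordinates let `A e` be an event that depends on the coordinates in `e` only. If the probability
that all the `A e` occur is very small, then small sets `R e`, which again depend on `e` only, have
to be found so that the sets `A e \ R e` have no common point (`exists_removal`).

The heart of the proof is a `RandomModel` of the colorings `x ↦ 1_{A e}(x)`. All sets `f` of
coordinates receive random colors which are independent given `x`; the law of the color of `f`
depends on the coordinates in `f` only, and it differs from a fixed law by functions that are
uniform, that is, nearly orthogonal to all products of functions each of which ignores one
coordinate of `f`. The colors of all `f ⊆ e` determine, up to an error of small probability, whether
`A e` occurs. It is crucial that the uniformity may be prescribed in terms of the number of colors,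
whereas the error probability need not be small in terms of that number. Then counting is easy
(`RandomModel.abs_expect_mul_prod_kernel_sub_le`): the random colors of sets not contained in `e`
are nearly independent of everything on `e`. Remove from `A e` the points whose random colors are
likely to be rare or to have a large conditional error probability. If a common point survives, its
random colors can be chosen to be typical on all `e` at once, and these colors alone produce many
points at which all the `A e` occur.

Random models are constructed by induction on the size of the sets (`exists_randomModel`). The
strong regularity lemma `exists_coarse_fine_partition`, an energy increment argument, provides a
coarse and a fine partition of the facets of the edges `e` such that the conditional probabilities
of the colors of `e` given the two partitions are close in mean, and such that the fine partition
leaves a remainder which is uniform relative to the size of the coarse one. The random color of `e`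
is a response function, which names a color of `e` for each possible coarse type of its facets
(`exists_response`). The response to the actual type is coupled with the actual color by means of
the fine conditional probabilities, whence the response function is independent of everything on
the facets up to a uniform error, and it errs only where the coarse and the fine conditional
probabilities differ. The coarse facet colors themselves are modeled by the induction hypothesis.
-/

namespace HypergraphRemoval

/-! ### Finite product probability spaces -/

section Expectation

variable {J : Type*} [Fintype J] [DecidableEq J] {Ω : J → Type*} [∀ j, Fintype (Ω j)]

/-- Every `w j` is a probability vector. -/
structure IsProb {J : Type*} {Ω : J → Type*} [∀ j, Fintype (Ω j)] (w : ∀ j, Ω j → ℝ) : Prop where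
  nonneg : ∀ j x, 0 ≤ w j x
  sum_eq_one : ∀ j, ∑ x, w j x = 1

/-- The expectation of `F` for independent coordinates, the `j`-th distributed according to the
weights `w j`. The same notion serves for random vertices and for random colors. -/
def expect (w : ∀ j, Ω j → ℝ) (F : (∀ j, Ω j) → ℝ) : ℝ :=
  ∑ x, (∏ j, w j (x j)) * F x

variable {w w' : ∀ j, Ω j → ℝ} {F F' : (∀ j, Ω j) → ℝ}

theorem expect_add : expect w (fun x => F x + F' x) = expect w F + expect w F' := by
  simp only [expect, mul_add, Finset.sum_add_distrib]

theorem expect_sub : expect w (fun x => F x - F' x) = expect w F - expect w F' := by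
  simp only [expect, mul_sub, Finset.sum_sub_distrib]

theorem expect_const_mul (a : ℝ) : expect w (fun x => a * F x) = a * expect w F := by
  simp only [expect, Finset.mul_sum]
  exact Finset.sum_congr rfl fun x _ => by ring

theorem expect_mul_const (a : ℝ) : expect w (fun x => F x * a) = expect w F * a := by
  simp only [expect, Finset.sum_mul]
  exact Finset.sum_congr rfl fun x _ => by ring

theorem expect_finset_sum {κ : Type*} (s : Finset κ) (F : κ → (∀ j, Ω j) → ℝ) :
    expect w (fun x => ∑ i ∈ s, F i x) = ∑ i ∈ s, expect w (F i) := by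
  simp only [expect, Finset.mul_sum]
  exact Finset.sum_comm

theorem expect_one (hw : IsProb w) : expect w (fun _ => 1) = 1 := by
  simp only [expect, mul_one]
  rw [← Fintype.piFinset_univ, ← Finset.prod_univ_sum]
  simp [hw.sum_eq_one]

theorem expect_const (hw : IsProb w) (a : ℝ) : expect w (fun _ => a) = a := by
  have := expect_const_mul (w := w) (F := fun _ => 1) a
  simpa [expect_one hw] using this

omit [DecidableEq J] in
theorem prod_weight_nonneg (hw : IsProb w) (x : ∀ j, Ω j) : 0 ≤ ∏ j, w j (x j) :=
  Finset.prod_nonneg fun j _ => hw.nonneg j _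

theorem expect_mono (hw : IsProb w) (h : ∀ x, F x ≤ F' x) : expect w F ≤ expect w F' :=
  Finset.sum_le_sum fun x _ => mul_le_mul_of_nonneg_left (h x) (prod_weight_nonneg hw x)

theorem expect_nonneg (hw : IsProb w) (h : ∀ x, 0 ≤ F x) : 0 ≤ expect w F :=
  Finset.sum_nonneg fun x _ => mul_nonneg (prod_weight_nonneg hw x) (h x)

theorem expect_le_of_le (hw : IsProb w) {a : ℝ} (h : ∀ x, F x ≤ a) : expect w F ≤ a :=
  (expect_mono hw h).trans_eq (expect_const hw a)

theorem abs_expect_le (hw : IsProb w) : |expect w F| ≤ expect w fun x => |F x| := by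
  refine (Finset.abs_sum_le_sum_abs _ _).trans_eq (Finset.sum_congr rfl fun x _ => ?_)
  rw [abs_mul, abs_of_nonneg (prod_weight_nonneg hw x)]

theorem exists_lt_of_lt_expect (hw : IsProb w) {a : ℝ} (h : a < expect w F) : ∃ x, a < F x := by
  by_contra! hx
  exact absurd (expect_le_of_le hw hx) (not_le.2 h)

theorem sq_expect_le (hw : IsProb w) : expect w F ^ 2 ≤ expect w fun x => F x ^ 2 := by
  have h : 0 ≤ expect w fun x => (F x - expect w F) ^ 2 := expect_nonneg hw fun x => sq_nonneg _
  have e : (fun x => (F x - expect w F) ^ 2)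
      = fun x => (F x ^ 2 - 2 * expect w F * F x) + expect w F ^ 2 := by
    funext x; ring
  rw [e, expect_add, expect_sub, expect_const_mul, expect_const hw] at h
  nlinarith

theorem IsProb.nonempty (hw : IsProb w) : Nonempty (∀ j, Ω j) := by
  by_contra h
  rw [not_nonempty_iff] at h
  have := expect_one hw
  simp [expect] at this

/-- Exchanging the coordinates in `S` between two independent points preserves their joint law,
if the weights agree on `S`. -/
theorem expect_expect_swap (S : Finset J) (h : ∀ j ∈ S, w j = w' j)
    (H : (∀ j, Ω j) → (∀ j, Ω j) → ℝ) :
    expect w (fun x => expect w' fun z => H x z) =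
      expect w (fun x => expect w' fun z => H (S.piecewise z x) (S.piecewise x z)) := by
  let σ : (∀ j, Ω j) × (∀ j, Ω j) → (∀ j, Ω j) × (∀ j, Ω j) :=
    fun p => (S.piecewise p.2 p.1, S.piecewise p.1 p.2)
  have hσ : Function.Involutive σ := by
    intro p
    refine Prod.ext ?_ ?_ <;> funext j <;> by_cases hj : j ∈ S <;> simp [σ, hj]
  have key : ∀ G : (∀ j, Ω j) → (∀ j, Ω j) → ℝ,
      expect w (fun x => expect w' fun z => G x z) =
        ∑ p : (∀ j, Ω j) × (∀ j, Ω j), ((∏ j, w j (p.1 j)) * ∏ j, w' j (p.2 j)) * G p.1 p.2 := by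
    intro G
    rw [Fintype.sum_prod_type]
    simp only [expect, Finset.mul_sum, mul_assoc]
  rw [key, key, ← Equiv.sum_comp hσ.toPerm]
  refine Finset.sum_congr rfl fun p _ => ?_
  rw [← Finset.prod_mul_distrib, ← Finset.prod_mul_distrib]
  congr 1
  refine Finset.prod_congr rfl fun j _ => ?_
  by_cases hj : j ∈ S
  · simp [σ, hj, h j hj, mul_comm]
  · simp [σ, hj]

/-- The expectation of a function depends only on the weights of the coordinates it reads. -/
theorem expect_congr_weight (hw : IsProb w) (hw' : IsProb w') {S : Finset J}
    (h : ∀ j ∈ S, w j = w' j) (hF : DependsOn F S) : expect w F = expect w' F := by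
  have e := expect_expect_swap S h fun x _ => F x
  have hx : ∀ x z : ∀ j, Ω j, F (S.piecewise z x) = F z := fun x z =>
    hF fun j hj => Finset.piecewise_eq_of_mem _ _ _ hj
  simpa [hx, expect_const hw', expect_const hw] using e

theorem expect_expect_piecewise (hw : IsProb w) (S : Finset J) :
    expect w (fun z => expect w fun x => F (S.piecewise x z)) = expect w F := by
  have e := expect_expect_swap (w := w) (w' := w) S (fun _ _ => rfl) fun x _ => F x
  rw [← e]
  simp [expect_const hw]

theorem expect_map {Ω' : J → Type*} [∀ j, Fintype (Ω' j)] [∀ j, DecidableEq (Ω' j)]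
    (g : ∀ j, Ω j → Ω' j) (G : (∀ j, Ω' j) → ℝ) :
    expect w (fun x => G fun j => g j (x j)) =
      expect (fun j b => ∑ x with g j x = b, w j x) G := by
  simp only [expect]
  rw [← Finset.sum_fiberwise (s := Finset.univ) (g := fun (x : ∀ j, Ω j) j => g j (x j))]
  refine Finset.sum_congr rfl fun b _ => ?_
  rw [Finset.prod_univ_sum, Finset.sum_mul]
  have hs : (Finset.univ.filter fun x : ∀ j, Ω j => (fun j => g j (x j)) = b)
      = Fintype.piFinset fun j => Finset.univ.filter fun x => g j x = b j := by
    ext x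
    simp [funext_iff]
  rw [← hs]
  refine Finset.sum_congr rfl fun x hx => ?_
  rw [(Finset.mem_filter.1 hx).2]

/-- A product of test functions changes by at most the sum of the changes of the factors. -/
theorem abs_prod_sub_prod_le {κ : Type*} (s : Finset κ) {u v : κ → ℝ}
    (hu : ∀ i ∈ s, 0 ≤ u i ∧ u i ≤ 1) (hv : ∀ i ∈ s, 0 ≤ v i ∧ v i ≤ 1) :
    |∏ i ∈ s, u i - ∏ i ∈ s, v i| ≤ ∑ i ∈ s, |u i - v i| := by
  classical
  induction s using Finset.induction_on with
  | empty => simp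
  | insert a s ha ih =>
    rw [Finset.prod_insert ha, Finset.prod_insert ha, Finset.sum_insert ha]
    have ih' := ih (fun i hi => hu i (Finset.mem_insert_of_mem hi))
      (fun i hi => hv i (Finset.mem_insert_of_mem hi))
    have hua := hu a (Finset.mem_insert_self _ _)
    have hV0 : 0 ≤ ∏ i ∈ s, v i :=
      Finset.prod_nonneg fun i hi => (hv i (Finset.mem_insert_of_mem hi)).1
    have hV1 : ∏ i ∈ s, v i ≤ 1 :=
      Finset.prod_le_one (fun i hi => (hv i (Finset.mem_insert_of_mem hi)).1)
        fun i hi => (hv i (Finset.mem_insert_of_mem hi)).2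
    calc |u a * ∏ i ∈ s, u i - v a * ∏ i ∈ s, v i|
        = |u a * (∏ i ∈ s, u i - ∏ i ∈ s, v i) + (u a - v a) * ∏ i ∈ s, v i| := by
          congr 1; ring
      _ ≤ |u a * (∏ i ∈ s, u i - ∏ i ∈ s, v i)| + |(u a - v a) * ∏ i ∈ s, v i| := abs_add_le _ _
      _ ≤ 1 * |∏ i ∈ s, u i - ∏ i ∈ s, v i| + |u a - v a| * 1 := by
          rw [abs_mul, abs_mul, abs_of_nonneg hua.1, abs_of_nonneg hV0]
          gcongr
          exact hua.2
      _ ≤ _ := by linarith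

end Expectation

section Eval

variable {J K : Type*} [Fintype J] [DecidableEq J] [Fintype K] {w : J → K → ℝ}

theorem expect_eval (hw : IsProb w) (i : J) (G : K → ℝ) :
    expect w (fun a => G (a i)) = ∑ b, w i b * G b := by
  have h : ∀ a : J → K, (∏ j, w j (a j)) * G (a i)
      = ∏ j, w j (a j) * (if j = i then G (a j) else 1) := by
    intro a
    rw [Finset.prod_mul_distrib, Finset.prod_ite_eq']
    simp
  simp only [expect, h]
  rw [← Fintype.piFinset_univ,
    ← Finset.prod_univ_sum (fun _ => Finset.univ)
      (fun j b => w j b * (if j = i then G b else 1)),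
    Finset.prod_eq_single i]
  · simp
  · intro j _ hj
    simp [hj, hw.sum_eq_one]
  · simp

end Eval

/-! ### Uniform functions -/

section Uniform

variable {J : Type*} [Fintype J] [DecidableEq J] {Ω : J → Type*} [∀ j, Fintype (Ω j)]

/-- `g` is `η`-uniform on the edge `e`: it has correlation at most `η` with all products of
`[0, 1]`-valued test functions, one for each `j ∈ e`, that do not depend on the coordinate `j`. -/
def IsUniform (w : ∀ j, Ω j → ℝ) (e : Finset J) (g : (∀ j, Ω j) → ℝ) (η : ℝ) : Prop :=
  ∀ v : J → (∀ j, Ω j) → ℝ, (∀ j ∈ e, ∀ x, 0 ≤ v j x ∧ v j x ≤ 1) →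
    (∀ j ∈ e, DependsOn (v j) {j}ᶜ) → |expect w fun x => g x * ∏ j ∈ e, v j x| ≤ η

variable {w : ∀ j, Ω j → ℝ} {e : Finset J} {g g' : (∀ j, Ω j) → ℝ} {η η' : ℝ}

theorem IsUniform.mono (h : IsUniform w e g η) (hη : η ≤ η') : IsUniform w e g η' :=
  fun v hv hd => (h v hv hd).trans hη

theorem isUniform_zero (hη : 0 ≤ η) : IsUniform w e (fun _ => 0) η := by
  intro v _ _
  simpa [expect] using hη

theorem IsUniform.const_mul (h : IsUniform w e g η) {a : ℝ} (ha : |a| ≤ 1) :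
    IsUniform w e (fun x => a * g x) η := by
  intro v hv hd
  simp only [mul_assoc]
  rw [expect_const_mul, abs_mul]
  have := h v hv hd
  nlinarith [abs_nonneg (expect w fun x => g x * ∏ j ∈ e, v j x), abs_nonneg a]

theorem IsUniform.sum {κ : Type*} (s : Finset κ) {g : κ → (∀ j, Ω j) → ℝ}
    (h : ∀ i ∈ s, IsUniform w e (g i) η) :
    IsUniform w e (fun x => ∑ i ∈ s, g i x) (s.card * η) := by
  intro v hv hd
  simp only [Finset.sum_mul]
  rw [expect_finset_sum]
  refine (Finset.abs_sum_le_sum_abs _ _).trans ?_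
  refine (Finset.sum_le_sum fun i hi => h i hi v hv hd).trans_eq ?_
  simp

/-- Uniform functions are tested by any product of functions each of which misses a vertex of
the edge. -/
theorem IsUniform.abs_expect_mul_prod_le (h : IsUniform w e g η) {κ : Type*} (s : Finset κ)
    {u : κ → (∀ j, Ω j) → ℝ} (hu : ∀ i ∈ s, ∀ x, 0 ≤ u i x ∧ u i x ≤ 1)
    (hd : ∀ i ∈ s, ∃ j ∈ e, DependsOn (u i) {j}ᶜ) :
    |expect w fun x => g x * ∏ i ∈ s, u i x| ≤ η := by
  classical
  rcases s.eq_empty_or_nonempty with rfl | ⟨i₀, hi₀⟩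
  · simpa using h (fun _ _ => 1) (by simp) fun j _ x y _ => rfl
  have : Nonempty J := ⟨(hd i₀ hi₀).choose⟩
  choose! f hfe hf using hd
  have := h (fun j x => ∏ i ∈ s with f i = j, u i x)
    (fun j _ x => ⟨Finset.prod_nonneg fun i hi => (hu i (Finset.mem_filter.1 hi).1 x).1,
      Finset.prod_le_one (fun i hi => (hu i (Finset.mem_filter.1 hi).1 x).1)
        fun i hi => (hu i (Finset.mem_filter.1 hi).1 x).2⟩)
    (fun j _ x y hxy => Finset.prod_congr rfl fun i hi => by
      obtain ⟨his, rfl⟩ := Finset.mem_filter.1 hi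
      exact hf i his hxy)
  simpa only [Finset.prod_fiberwise_of_maps_to hfe] using this

end Uniform

/-! ### Conditional expectations with respect to finite partitions -/

section CondExpect

variable {J : Type*} [Fintype J] [DecidableEq J] {Ω : J → Type*} [∀ j, Fintype (Ω j)]
  {T : Type*} [DecidableEq T]

/-- The mean of `F` over the fiber of `τ` above `t`. Over a fiber of probability zero it is the
mean of `F` over the whole space, so that averaging preserves constants everywhere. -/
noncomputable def fiberMean (w : ∀ j, Ω j → ℝ) (τ : (∀ j, Ω j) → T) (F : (∀ j, Ω j) → ℝ) (t : T) :
    ℝ :=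
  if expect w (fun y => if τ y = t then 1 else 0) = 0 then expect w F
  else expect w (fun y => if τ y = t then F y else 0) / expect w fun y => if τ y = t then 1 else 0

variable {w : ∀ j, Ω j → ℝ} {τ : (∀ j, Ω j) → T} {F φ : (∀ j, Ω j) → ℝ}

theorem fiberMean_nonneg (hw : IsProb w) (hF : ∀ x, 0 ≤ F x) (t : T) : 0 ≤ fiberMean w τ F t := by
  unfold fiberMean
  split_ifs
  · exact expect_nonneg hw hF
  · refine div_nonneg (expect_nonneg hw fun x => ?_) (expect_nonneg hw fun x => ?_) <;>
      split_ifs <;> simp [hF]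

theorem sum_fiberMean {κ : Type*} (s : Finset κ) {F : κ → (∀ j, Ω j) → ℝ} (hw : IsProb w)
    (hF : ∀ x, ∑ i ∈ s, F i x = 1) (t : T) : ∑ i ∈ s, fiberMean w τ (F i) t = 1 := by
  unfold fiberMean
  split_ifs with h
  · rw [← expect_finset_sum]
    simp [hF, expect_one hw]
  · rw [← Finset.sum_div, ← expect_finset_sum, div_eq_one_iff_eq h]
    congr 1
    funext x
    split_ifs
    · exact hF x
    · simp

/-- The defining property of the conditional expectation `fiberMean w τ F ∘ τ`. -/
theorem expect_fiberMean_mul [Fintype T] (hw : IsProb w) (hφ : φ.FactorsThrough τ) :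
    expect w (fun x => fiberMean w τ F (τ x) * φ x) = expect w fun x => F x * φ x := by
  simp only [expect]
  rw [← Finset.sum_fiberwise Finset.univ τ, ← Finset.sum_fiberwise Finset.univ τ]
  refine Finset.sum_congr rfl fun t _ => ?_
  rcases (Finset.univ.filter fun x => τ x = t).eq_empty_or_nonempty with h | ⟨y, hy⟩
  · simp [h]
  have hy := (Finset.mem_filter.1 hy).2
  have h1 : ∀ x ∈ Finset.univ.filter fun x => τ x = t,
      (∏ j, w j (x j)) * (fiberMean w τ F (τ x) * φ x)
        = (∏ j, w j (x j)) * (fiberMean w τ F t * φ y) := by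
    intro x hx
    have hx := (Finset.mem_filter.1 hx).2
    rw [hx, hφ (hx.trans hy.symm)]
  have h2 : ∀ x ∈ Finset.univ.filter fun x => τ x = t,
      (∏ j, w j (x j)) * (F x * φ x) = (∏ j, w j (x j)) * F x * φ y := by
    intro x hx
    have hx := (Finset.mem_filter.1 hx).2
    rw [hφ (hx.trans hy.symm)]
    ring
  rw [Finset.sum_congr rfl h1, Finset.sum_congr rfl h2, ← Finset.sum_mul, ← Finset.sum_mul,
    ← mul_assoc]
  congr 1
  have hm : ∀ G : (∀ j, Ω j) → ℝ, expect w (fun y => if τ y = t then G y else 0)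
      = ∑ x with τ x = t, (∏ j, w j (x j)) * G x := by
    intro G
    simp only [expect, mul_ite, mul_zero, Finset.sum_filter]
  have hm1 := hm fun _ => 1
  simp only [mul_one] at hm1
  unfold fiberMean
  rw [hm1, hm F]
  split_ifs with h0
  · rw [h0, zero_mul]
    refine (Finset.sum_eq_zero fun x hx => ?_).symm
    rw [(Finset.sum_eq_zero_iff_of_nonneg fun x _ => prod_weight_nonneg hw x).1 h0 x hx, zero_mul]
  · field_simp

/-- Pythagoras for the conditional expectations given two partitions, the second one finer. -/
theorem expect_sq_fiberMean_sub {T' : Type*} [DecidableEq T'] [Fintype T] [Fintype T']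
    {τ' : (∀ j, Ω j) → T'} (hw : IsProb w) (h : τ.FactorsThrough τ') :
    expect w (fun x => (fiberMean w τ' F (τ' x) - fiberMean w τ F (τ x)) ^ 2) =
      expect w (fun x => fiberMean w τ' F (τ' x) ^ 2) -
        expect w fun x => fiberMean w τ F (τ x) ^ 2 := by
  have hp : (fun x => fiberMean w τ F (τ x)).FactorsThrough τ := fun x y hxy => by simp [hxy]
  have hp' : (fun x => fiberMean w τ F (τ x)).FactorsThrough τ' := fun x y hxy => hp (h hxy)
  have e1 := expect_fiberMean_mul (F := F) hw hp
  have e2 := expect_fiberMean_mul (F := F) hw hp'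
  have : (fun x => (fiberMean w τ' F (τ' x) - fiberMean w τ F (τ x)) ^ 2) =
      fun x => (fiberMean w τ' F (τ' x) ^ 2 - fiberMean w τ F (τ x) ^ 2)
        + 2 * (fiberMean w τ F (τ x) * fiberMean w τ F (τ x)
          - fiberMean w τ' F (τ' x) * fiberMean w τ F (τ x)) := by
    funext x; ring
  rw [this, expect_add, expect_sub, expect_const_mul, expect_sub, e1, e2]
  ring

end CondExpect

/-! ### Partitions of the facets of all edges -/

section Facet

variable {J : Type*} [Fintype J] [DecidableEq J] {Ω : J → Type*} [∀ j, Fintype (Ω j)]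
  {C : Type*} [Fintype C] [DecidableEq C]

/-- `B e j` is a coloring of the facet `e \ {j}` of `e`, for `j ∈ e`; it is constant
for `j ∉ e`. -/
def IsFacetColoring {J : Type*} {Ω : J → Type*} {β : Type*}
    (B : Finset J → J → (∀ j, Ω j) → β) : Prop :=
  ∀ e j, DependsOn (B e j) {i | j ∈ e ∧ i ∈ e ∧ i ≠ j}

/-- The colors of all facets of the edge `e` of `x`. -/
def facetType {J : Type*} {Ω : J → Type*} {β : Type*} (B : Finset J → J → (∀ j, Ω j) → β)
    (e : Finset J) (x : ∀ j, Ω j) : J → β :=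
  fun j => B e j x

/-- The indicator of the color `a` in the coloring `c`. -/
def colorInd {X : Type*} (c : X → C) (a : C) (x : X) : ℝ :=
  if c x = a then 1 else 0

omit [Fintype C] in
theorem colorInd_mem {X : Type*} (c : X → C) (a : C) (x : X) :
    0 ≤ colorInd c a x ∧ colorInd c a x ≤ 1 := by
  unfold colorInd
  split_ifs <;> simp

theorem sum_colorInd {X : Type*} (c : X → C) (x : X) : ∑ a, colorInd c a x = 1 := by
  simp [colorInd]

/-- The conditional probability of the color `a` of the edge `e`, given the facet colors `t`. -/
noncomputable def colorProb {m : ℕ} (w : ∀ j, Ω j → ℝ) (c : Finset J → (∀ j, Ω j) → C)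
    (B : Finset J → J → (∀ j, Ω j) → Fin m) (e : Finset J) (t : J → Fin m) (a : C) : ℝ :=
  fiberMean w (facetType B e) (colorInd (c e) a) t

variable {w : ∀ j, Ω j → ℝ} {c : Finset J → (∀ j, Ω j) → C} {m m' : ℕ}
  {B : Finset J → J → (∀ j, Ω j) → Fin m} {B' : Finset J → J → (∀ j, Ω j) → Fin m'}

omit [Fintype C] in
theorem colorProb_nonneg (hw : IsProb w) (e : Finset J) (t : J → Fin m) (a : C) :
    0 ≤ colorProb w c B e t a :=
  fiberMean_nonneg hw (fun x => (colorInd_mem _ _ x).1) t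

theorem sum_colorProb (hw : IsProb w) (e : Finset J) (t : J → Fin m) :
    ∑ a, colorProb w c B e t a = 1 :=
  sum_fiberMean _ hw (sum_colorInd (c e)) t

theorem colorProb_le_one (hw : IsProb w) (e : Finset J) (t : J → Fin m) (a : C) :
    colorProb w c B e t a ≤ 1 := by
  rw [← sum_colorProb hw (c := c) (B := B) e t]
  exact Finset.single_le_sum (fun a _ => colorProb_nonneg hw e t a) (Finset.mem_univ a)

omit [Fintype J] [DecidableEq J] [∀ j, Fintype (Ω j)] in
theorem IsFacetColoring.dependsOn_facetType {β : Type*} {B : Finset J → J → (∀ j, Ω j) → β}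
    (hB : IsFacetColoring B) (e : Finset J) : DependsOn (facetType B e) (e : Set J) := by
  intro x y h
  funext j
  exact hB e j fun i hi => h i hi.2.1

/-- The mean square of the conditional color probabilities, summed over edges and colors. -/
noncomputable def energy (w : ∀ j, Ω j → ℝ) (c : Finset J → (∀ j, Ω j) → C)
    (B : Finset J → J → (∀ j, Ω j) → Fin m) : ℝ :=
  ∑ e, ∑ a, expect w fun x => colorProb w c B e (facetType B e x) a ^ 2

theorem energy_nonneg (hw : IsProb w) : 0 ≤ energy w c B :=
  Finset.sum_nonneg fun _ _ => Finset.sum_nonneg fun _ _ => expect_nonneg hw fun _ => sq_nonneg _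

theorem energy_le (hw : IsProb w) : energy w c B ≤ 2 ^ Fintype.card J := by
  have : ∀ e : Finset J, ∑ a, expect w (fun x => colorProb w c B e (facetType B e x) a ^ 2) ≤ 1 := by
    intro e
    rw [← expect_finset_sum]
    refine expect_le_of_le hw fun x => ?_
    rw [← sum_colorProb hw (c := c) (B := B) e (facetType B e x)]
    refine Finset.sum_le_sum fun a _ => ?_
    have := colorProb_nonneg hw (c := c) (B := B) e (facetType B e x) a
    have := colorProb_le_one hw (c := c) (B := B) e (facetType B e x) a
    nlinarith
  refine (Finset.sum_le_sum fun e _ => this e).trans_eq ?_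
  simp

/-- `B'` refines `B`. -/
def Refines {J : Type*} {X : Type*} {β β' : Type*} (B' : Finset J → J → X → β')
    (B : Finset J → J → X → β) : Prop :=
  ∀ e j, (B e j).FactorsThrough (B' e j)

theorem Refines.refl {J X β : Type*} (B : Finset J → J → X → β) : Refines B B :=
  fun _ _ _ _ h => h

theorem Refines.trans {J X β β' β'' : Type*} {B : Finset J → J → X → β}
    {B' : Finset J → J → X → β'} {B'' : Finset J → J → X → β''} (h' : Refines B'' B')
    (h : Refines B' B) : Refines B'' B :=
  fun e j _ _ hxy => h e j (h' e j hxy)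

omit [Fintype J] [DecidableEq J] [∀ j, Fintype (Ω j)] in
theorem Refines.facetType {β β' : Type*} {B : Finset J → J → (∀ j, Ω j) → β}
    {B' : Finset J → J → (∀ j, Ω j) → β'} (h : Refines B' B) (e : Finset J) :
    (facetType B e).FactorsThrough (facetType B' e) := by
  intro x y hxy
  funext j
  exact h e j (congrFun hxy j)

/-- The energy increment under refinement, at a single edge and color. -/
theorem expect_sq_sub_le_energy_sub (hw : IsProb w) (h : Refines B' B) (e : Finset J) (a : C) :
    expect w (fun x => (colorProb w c B' e (facetType B' e x) a
      - colorProb w c B e (facetType B e x) a) ^ 2) ≤ energy w c B' - energy w c B := by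
  have key : ∀ e a, expect w (fun x => (colorProb w c B' e (facetType B' e x) a
      - colorProb w c B e (facetType B e x) a) ^ 2) =
      expect w (fun x => colorProb w c B' e (facetType B' e x) a ^ 2) -
      expect w (fun x => colorProb w c B e (facetType B e x) a ^ 2) := fun e a =>
    expect_sq_fiberMean_sub hw (h.facetType e)
  simp only [energy, ← Finset.sum_sub_distrib, ← key]
  refine le_trans ?_ (Finset.single_le_sum (f := fun e => ∑ a, expect w fun x =>
    (colorProb w c B' e (facetType B' e x) a - colorProb w c B e (facetType B e x) a) ^ 2)
    (fun e _ => Finset.sum_nonneg fun a _ => expect_nonneg hw fun x => sq_nonneg _)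
    (Finset.mem_univ e))
  exact Finset.single_le_sum (f := fun a => expect w fun x =>
    (colorProb w c B' e (facetType B' e x) a - colorProb w c B e (facetType B e x) a) ^ 2)
    (fun a _ => expect_nonneg hw fun x => sq_nonneg _) (Finset.mem_univ a)

/-- The deviations of the colors from their conditional probabilities given the facet colors `B`
are `ζ`-uniform, even after multiplication with any function of the facet colors. -/
def IsUniformPartition (w : ∀ j, Ω j → ℝ) (c : Finset J → (∀ j, Ω j) → C)
    (B : Finset J → J → (∀ j, Ω j) → Fin m) (ζ : ℝ) : Prop :=
  ∀ e a (φ : (∀ j, Ω j) → ℝ), φ.FactorsThrough (facetType B e) → (∀ x, 0 ≤ φ x ∧ φ x ≤ 1) →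
    IsUniform w e (fun x => (colorInd (c e) a x - colorProb w c B e (facetType B e x) a) * φ x) ζ

/-- If a partition is not uniform, then the level sets of rounded test functions refine it to one
of larger energy. -/
theorem exists_refinement_of_not_isUniformPartition (hw : IsProb w)
    (hc : ∀ e, DependsOn (c e) (e : Set J)) (hB : IsFacetColoring B) {ζ : ℝ} (hζ : 0 < ζ) {N : ℕ}
    (hN : 2 * (Fintype.card J : ℝ) ≤ ζ * N) (hN0 : 0 < N) (h : ¬ IsUniformPartition w c B ζ) :
    ∃ B' : Finset J → J → (∀ j, Ω j) → Fin (m * (N + 1)), IsFacetColoring B' ∧ Refines B' B ∧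
      energy w c B + ζ ^ 2 / 4 ≤ energy w c B' := by
  simp only [IsUniformPartition, IsUniform, not_forall, not_le] at h
  obtain ⟨e, a, φ, hφ, hφ01, v, hv, hvd, hlt⟩ := h
  set g : (∀ j, Ω j) → ℝ :=
    fun x => (colorInd (c e) a x - colorProb w c B e (facetType B e x) a) * φ x with hg
  have hgd : DependsOn g (e : Set J) := by
    intro x y hxy
    have h1 : c e x = c e y := hc e hxy
    have h2 : facetType B e x = facetType B e y := hB.dependsOn_facetType e hxy
    simp only [hg, colorInd, h1, h2, hφ h2]
  have hg1 : ∀ x, |g x| ≤ 1 := by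
    intro x
    have h1 := colorInd_mem (c e) a x
    have h2 := colorProb_nonneg hw (c := c) (B := B) e (facetType B e x) a
    have h3 := colorProb_le_one hw (c := c) (B := B) e (facetType B e x) a
    rw [hg, abs_mul, abs_of_nonneg (hφ01 x).1]
    have : |colorInd (c e) a x - colorProb w c B e (facetType B e x) a| ≤ 1 := by
      rw [abs_le]; constructor <;> linarith
    nlinarith [hφ01 x, abs_nonneg (colorInd (c e) a x - colorProb w c B e (facetType B e x) a)]
  -- Freeze the coordinates outside `e`: then the test functions only read facets of `e`.
  obtain ⟨z, hz⟩ : ∃ z, ζ < |expect w fun x => g x * ∏ j ∈ e, v j (e.piecewise x z)| := by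
    apply exists_lt_of_lt_expect hw
    refine hlt.trans_le ?_
    rw [← expect_expect_piecewise hw e]
    refine (abs_expect_le hw).trans_eq ?_
    congr 1
    funext z
    congr 2
    funext x
    congr 1
    exact hgd fun j hj => Finset.piecewise_eq_of_mem _ _ _ hj
  have hNr : (0 : ℝ) < N := by exact_mod_cast hN0
  have hlvl : ∀ j ∈ e, ∀ x, ⌊(N : ℝ) * v j (e.piecewise x z)⌋₊ < N + 1 := by
    intro j hj x
    rw [Nat.floor_lt (by have := (hv j hj (e.piecewise x z)).1; positivity)]
    push_cast
    nlinarith [(hv j hj (e.piecewise x z)).2]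
  let lvl : Finset J → J → (∀ j, Ω j) → Fin (N + 1) := fun e' j x =>
    if h : e' = e ∧ j ∈ e then ⟨_, hlvl j h.2 x⟩ else 0
  let B' : Finset J → J → (∀ j, Ω j) → Fin (m * (N + 1)) :=
    fun e' j x => finProdFinEquiv (B e' j x, lvl e' j x)
  have hB'eq : ∀ e' j x y, B' e' j x = B' e' j y ↔ B e' j x = B e' j y ∧ lvl e' j x = lvl e' j y := by
    intro e' j x y
    simp [B']
  have hB' : IsFacetColoring B' := by
    intro e' j x y hxy
    rw [hB'eq]
    refine ⟨hB e' j hxy, ?_⟩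
    by_cases h : e' = e ∧ j ∈ e
    · obtain ⟨rfl, hj⟩ := h
      have : v j (e'.piecewise x z) = v j (e'.piecewise y z) := by
        refine hvd j hj fun i hi => ?_
        by_cases hie : i ∈ e'
        · simpa [hie] using hxy i ⟨hj, hie, hi⟩
        · simp [hie]
      simp [lvl, this]
    · simp [lvl, h]
  have hR : Refines B' B := fun e' j x y hxy => ((hB'eq e' j x y).1 hxy).1
  refine ⟨B', hB', hR, ?_⟩
  let u : J → (∀ j, Ω j) → ℝ := fun j x => (lvl e j x : ℕ) / (N : ℝ)
  have hu : ∀ j ∈ e, ∀ x, 0 ≤ u j x ∧ u j x ≤ 1 := by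
    intro j _ x
    refine ⟨by positivity, ?_⟩
    rw [div_le_one hNr]
    exact_mod_cast Nat.lt_succ_iff.1 (lvl e j x).2
  have huv : ∀ j ∈ e, ∀ x, |u j x - v j (e.piecewise x z)| ≤ 1 / N := by
    intro j hj x
    have h0 : 0 ≤ (N : ℝ) * v j (e.piecewise x z) := by
      have := (hv j hj (e.piecewise x z)).1; positivity
    have h1 := Nat.floor_le h0
    have h2 := Nat.lt_floor_add_one ((N : ℝ) * v j (e.piecewise x z))
    have : u j x = (⌊(N : ℝ) * v j (e.piecewise x z)⌋₊ : ℝ) / N := by simp [u, lvl, hj]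
    rw [this, abs_le]
    constructor
    · rw [← sub_nonneg]
      have : (⌊(N : ℝ) * v j (e.piecewise x z)⌋₊ : ℝ) / N - v j (e.piecewise x z) - -(1 / N)
        = ((⌊(N : ℝ) * v j (e.piecewise x z)⌋₊ : ℝ) + 1 - N * v j (e.piecewise x z)) / N := by
        field_simp
        ring
      rw [this]
      exact div_nonneg (by linarith) hNr.le
    · have h3 : (⌊(N : ℝ) * v j (e.piecewise x z)⌋₊ : ℝ) / N ≤ v j (e.piecewise x z) := by
        rw [div_le_iff₀ hNr]; linarith
      have : (0 : ℝ) ≤ 1 / N := by positivity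
      linarith
  set Ψ : (∀ j, Ω j) → ℝ := fun x => φ x * ∏ j ∈ e, u j x with hΨ
  have hΨ1 : ∀ x, |Ψ x| ≤ 1 := by
    intro x
    have h0 : 0 ≤ ∏ j ∈ e, u j x := Finset.prod_nonneg fun j hj => (hu j hj x).1
    have h1 : ∏ j ∈ e, u j x ≤ 1 :=
      Finset.prod_le_one (fun j hj => (hu j hj x).1) fun j hj => (hu j hj x).2
    rw [hΨ, abs_mul, abs_of_nonneg (hφ01 x).1, abs_of_nonneg h0]
    nlinarith [hφ01 x]
  have hΨτ : Ψ.FactorsThrough (facetType B' e) := by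
    intro x y hxy
    have h1 := hφ (hR.facetType e hxy)
    have h2 : ∀ j, u j x = u j y := fun j => by
      have := ((hB'eq e j x y).1 (congrFun hxy j)).2
      simp [u, this]
    simp only [hΨ, h1, h2]
  have hround : |expect w (fun x => g x * ∏ j ∈ e, v j (e.piecewise x z))
      - expect w (fun x => g x * ∏ j ∈ e, u j x)| ≤ ζ / 2 := by
    rw [← expect_sub]
    refine (abs_expect_le hw).trans (expect_le_of_le hw fun x => ?_)
    rw [← mul_sub, abs_mul]
    have h1 := abs_prod_sub_prod_le e (fun j hj => hv j hj (e.piecewise x z)) fun j hj => hu j hj x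
    have h2 : ∑ j ∈ e, |v j (e.piecewise x z) - u j x| ≤ ∑ j ∈ e, 1 / (N : ℝ) :=
      Finset.sum_le_sum fun j hj => by rw [abs_sub_comm]; exact huv j hj x
    have h3 : ∑ j ∈ e, 1 / (N : ℝ) ≤ ζ / 2 := by
      have : (e.card : ℝ) ≤ Fintype.card J := by exact_mod_cast Finset.card_le_univ e
      rw [Finset.sum_const, nsmul_eq_mul, mul_one_div, div_le_iff₀ hNr]
      linarith
    have h4 := abs_nonneg (∏ j ∈ e, v j (e.piecewise x z) - ∏ j ∈ e, u j x)
    nlinarith [hg1 x]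
  have hbig : ζ / 2 ≤ |expect w fun x => g x * ∏ j ∈ e, u j x| := by
    have := abs_sub_abs_le_abs_sub (expect w (fun x => g x * ∏ j ∈ e, v j (e.piecewise x z)))
      (expect w (fun x => g x * ∏ j ∈ e, u j x))
    linarith
  -- The rounded test functions are functions of the refined facet colors, so that the coloring
  -- may be replaced by its conditional probability.
  have hswap : expect w (fun x => g x * ∏ j ∈ e, u j x) = expect w fun x =>
      (colorProb w c B' e (facetType B' e x) a - colorProb w c B e (facetType B e x) a) * Ψ x := by
    have h1 := expect_fiberMean_mul (F := colorInd (c e) a) hw hΨτ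
    have h2 : (fun x => g x * ∏ j ∈ e, u j x) = fun x =>
        colorInd (c e) a x * Ψ x - colorProb w c B e (facetType B e x) a * Ψ x := by
      funext x; simp only [hg, hΨ]; ring
    rw [h2, expect_sub, ← h1, ← expect_sub]
    simp only [colorProb, sub_mul]
  have hsq : (ζ / 2) ^ 2 ≤ energy w c B' - energy w c B := by
    calc (ζ / 2) ^ 2 ≤ |expect w fun x => g x * ∏ j ∈ e, u j x| ^ 2 := by gcongr
      _ = (expect w fun x => (colorProb w c B' e (facetType B' e x) a
          - colorProb w c B e (facetType B e x) a) * Ψ x) ^ 2 := by rw [sq_abs, hswap]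
      _ ≤ _ := sq_expect_le hw
      _ ≤ expect w fun x => (colorProb w c B' e (facetType B' e x) a
          - colorProb w c B e (facetType B e x) a) ^ 2 := by
        refine expect_mono hw fun x => ?_
        rw [mul_pow]
        have : Ψ x ^ 2 ≤ 1 := by rw [← sq_abs]; exact pow_le_one₀ (abs_nonneg _) (hΨ1 x)
        exact mul_le_of_le_one_right (sq_nonneg _) this
      _ ≤ _ := expect_sq_sub_le_energy_sub hw hR e a
  nlinarith

end Facet

/-! ### The regularity lemma -/

universe u v

/-- Every partition of the facets has a `ζ`-uniform refinement of bounded size. -/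
theorem exists_uniform_refinement (n : ℕ) (C : Type) [Fintype C] [DecidableEq C] {ζ : ℝ}
    (hζ : 0 < ζ) (m : ℕ) : ∃ M : ℕ, ∀ (J : Type u) [Fintype J] [DecidableEq J],
      Fintype.card J = n → ∀ (Ω : J → Type v) [∀ j, Fintype (Ω j)] (w : ∀ j, Ω j → ℝ), IsProb w →
      ∀ c : Finset J → (∀ j, Ω j) → C, (∀ e, DependsOn (c e) (e : Set J)) →
      ∀ B : Finset J → J → (∀ j, Ω j) → Fin m, IsFacetColoring B →
      ∃ m' ≤ M, ∃ B' : Finset J → J → (∀ j, Ω j) → Fin m',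
        IsFacetColoring B' ∧ Refines B' B ∧ IsUniformPartition w c B' ζ := by
  obtain ⟨N, hN⟩ := exists_nat_ge (2 * (n : ℝ) / ζ + 1)
  have hN0 : 0 < N := by
    have : (0 : ℝ) < N := lt_of_lt_of_le (by positivity) hN
    exact_mod_cast this
  have hN' : 2 * (n : ℝ) ≤ ζ * N := by
    have : 2 * (n : ℝ) / ζ ≤ N := by linarith
    rw [div_le_iff₀ hζ] at this
    linarith
  have main : ∀ t m : ℕ, ∃ M : ℕ, ∀ (J : Type u) [Fintype J] [DecidableEq J],
      Fintype.card J = n → ∀ (Ω : J → Type v) [∀ j, Fintype (Ω j)] (w : ∀ j, Ω j → ℝ), IsProb w →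
      ∀ c : Finset J → (∀ j, Ω j) → C, (∀ e, DependsOn (c e) (e : Set J)) →
      ∀ B : Finset J → J → (∀ j, Ω j) → Fin m, IsFacetColoring B →
      2 ^ n - t * (ζ ^ 2 / 4) ≤ energy w c B →
      ∃ m' ≤ M, ∃ B' : Finset J → J → (∀ j, Ω j) → Fin m',
        IsFacetColoring B' ∧ Refines B' B ∧ IsUniformPartition w c B' ζ := by
    intro t
    induction t with
    | zero =>
      intro m
      refine ⟨m, ?_⟩
      intro J _ _ hJ Ω _ w hw c hc B hB hE
      by_cases h : IsUniformPartition w c B ζ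
      · exact ⟨m, le_rfl, B, hB, Refines.refl B, h⟩
      obtain ⟨B', -, -, hE'⟩ := exists_refinement_of_not_isUniformPartition hw hc hB hζ
        (by rw [hJ]; exact hN') hN0 h
      have := energy_le hw (c := c) (B := B')
      rw [hJ] at this
      have : 0 < ζ ^ 2 / 4 := by positivity
      simp only [Nat.cast_zero, zero_mul, sub_zero] at hE
      linarith
    | succ t ih =>
      intro m
      obtain ⟨M, hM⟩ := ih (m * (N + 1))
      refine ⟨max m M, ?_⟩
      intro J _ _ hJ Ω _ w hw c hc B hB hE
      by_cases h : IsUniformPartition w c B ζ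
      · exact ⟨m, le_max_left _ _, B, hB, Refines.refl B, h⟩
      obtain ⟨B', hB', hR, hE'⟩ := exists_refinement_of_not_isUniformPartition hw hc hB hζ
        (by rw [hJ]; exact hN') hN0 h
      obtain ⟨m'', hm'', B'', h1, h2, h3⟩ := hM J hJ Ω w hw c hc B' hB' (by
        push_cast at hE
        linarith)
      exact ⟨m'', hm''.trans (le_max_right _ _), B'', h1, h2.trans hR, h3⟩
  obtain ⟨t, ht⟩ := exists_nat_ge (2 ^ n / (ζ ^ 2 / 4))
  obtain ⟨M, hM⟩ := main t m
  refine ⟨M, ?_⟩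
  intro J _ _ hJ Ω _ w hw c hc B hB
  refine hM J hJ Ω w hw c hc B hB ?_
  rw [div_le_iff₀ (by positivity)] at ht
  linarith [energy_nonneg hw (c := c) (B := B)]

/-- The strong regularity lemma: there are a coarse and a fine partition of the facets such that
the conditional probabilities of the colors with respect to the two partitions are close in mean,
the fine partition is uniform to a degree prescribed in terms of the size of the coarse one, and
the size of the coarse one is bounded. -/
theorem exists_coarse_fine_partition (n : ℕ) (C : Type) [Fintype C] [DecidableEq C] {σ : ℝ}
    (hσ : 0 < σ) (ζ : ℕ → ℝ) (hζ : ∀ m, 0 < ζ m) :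
    ∃ M : ℕ, ∀ (J : Type u) [Fintype J] [DecidableEq J],
      Fintype.card J = n → ∀ (Ω : J → Type v) [∀ j, Fintype (Ω j)] (w : ∀ j, Ω j → ℝ), IsProb w →
      ∀ c : Finset J → (∀ j, Ω j) → C, (∀ e, DependsOn (c e) (e : Set J)) →
      ∃ m ≤ M, ∃ B : Finset J → J → (∀ j, Ω j) → Fin m, IsFacetColoring B ∧
      ∃ (m' : ℕ) (B' : Finset J → J → (∀ j, Ω j) → Fin m'), IsFacetColoring B' ∧ Refines B' B ∧
        IsUniformPartition w c B' (ζ m) ∧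
        ∀ e, (expect w fun x => ∑ a, |colorProb w c B' e (facetType B' e x) a
          - colorProb w c B e (facetType B e x) a|) ≤ σ := by
  set s : ℝ := σ / (Fintype.card C + 1) with hs
  have hs0 : 0 < s := by positivity
  have main : ∀ t m : ℕ, ∃ M : ℕ, ∀ (J : Type u) [Fintype J] [DecidableEq J],
      Fintype.card J = n → ∀ (Ω : J → Type v) [∀ j, Fintype (Ω j)] (w : ∀ j, Ω j → ℝ), IsProb w →
      ∀ c : Finset J → (∀ j, Ω j) → C, (∀ e, DependsOn (c e) (e : Set J)) →
      ∀ B : Finset J → J → (∀ j, Ω j) → Fin m, IsFacetColoring B →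
      2 ^ n - t * s ^ 2 ≤ energy w c B →
      ∃ m ≤ M, ∃ B : Finset J → J → (∀ j, Ω j) → Fin m, IsFacetColoring B ∧
      ∃ (m' : ℕ) (B' : Finset J → J → (∀ j, Ω j) → Fin m'), IsFacetColoring B' ∧ Refines B' B ∧
        IsUniformPartition w c B' (ζ m) ∧ energy w c B' - energy w c B ≤ s ^ 2 := by
    intro t
    induction t with
    | zero =>
      intro m
      obtain ⟨M, hM⟩ := exists_uniform_refinement.{u, v} n C (hζ m) m
      refine ⟨m, ?_⟩
      intro J _ _ hJ Ω _ w hw c hc B hB hE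
      obtain ⟨m', -, B', hB', hR, hU⟩ := hM J hJ Ω w hw c hc B hB
      refine ⟨m, le_rfl, B, hB, m', B', hB', hR, hU, ?_⟩
      have := energy_le hw (c := c) (B := B')
      rw [hJ] at this
      have : 0 < s ^ 2 := by positivity
      simp only [Nat.cast_zero, zero_mul, sub_zero] at hE
      linarith
    | succ t ih =>
      intro m
      obtain ⟨M, hM⟩ := exists_uniform_refinement.{u, v} n C (hζ m) m
      choose M' hM' using ih
      refine ⟨max m ((Finset.range (M + 1)).sup M'), ?_⟩
      intro J _ _ hJ Ω _ w hw c hc B hB hE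
      obtain ⟨m', hm', B', hB', hR, hU⟩ := hM J hJ Ω w hw c hc B hB
      by_cases h : energy w c B' - energy w c B ≤ s ^ 2
      · exact ⟨m, le_max_left _ _, B, hB, m', B', hB', hR, hU, h⟩
      obtain ⟨m₁, hm₁, rest⟩ := hM' m' J hJ Ω w hw c hc B' hB' (by
        push_cast at hE
        linarith)
      refine ⟨m₁, hm₁.trans (le_max_of_le_right ?_), rest⟩
      exact Finset.le_sup (f := M') (Finset.mem_range.2 (Nat.lt_succ_of_le hm'))
  obtain ⟨t, ht⟩ := exists_nat_ge (2 ^ n / s ^ 2)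
  obtain ⟨M, hM⟩ := main t 1
  refine ⟨M, ?_⟩
  intro J _ _ hJ Ω _ w hw c hc
  obtain ⟨m, hm, B, hB, m', B', hB', hR, hU, hE⟩ :=
    hM J hJ Ω w hw c hc (fun _ _ _ => 0) (fun _ _ _ _ _ => rfl) (by
      rw [div_le_iff₀ (by positivity)] at ht
      linarith [energy_nonneg hw (c := c) (B := fun _ _ _ => (0 : Fin 1))])
  refine ⟨m, hm, B, hB, m', B', hB', hR, hU, fun e => ?_⟩
  rw [expect_finset_sum]
  have h1 : ∀ a : C, (expect w fun x => |colorProb w c B' e (facetType B' e x) a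
      - colorProb w c B e (facetType B e x) a|) ≤ s := by
    intro a
    refine le_of_sq_le_sq ?_ hs0.le
    refine (sq_expect_le hw).trans ?_
    simp only [sq_abs]
    exact (expect_sq_sub_le_energy_sub hw hR e a).trans hE
  refine (Finset.sum_le_sum fun a _ => h1 a).trans ?_
  rw [Finset.sum_const, nsmul_eq_mul, Finset.card_univ, hs, mul_div_assoc',
    div_le_iff₀ (by positivity)]
  nlinarith

/-! ### Couplings of color distributions -/

/-- Two probability vectors `p` and `q` have a coupling, given by its transition kernel `κ p q`
from `p` to `q`, whose probability of a change is at most the `ℓ¹`-distance. -/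
theorem exists_coupling (C : Type*) [Fintype C] [DecidableEq C] :
    ∃ κ : (C → ℝ) → (C → ℝ) → C → C → ℝ, ∀ p q : C → ℝ, (∀ a, 0 ≤ p a) → ∑ a, p a = 1 →
      (∀ a, 0 ≤ q a) → ∑ a, q a = 1 →
      (∀ a b, 0 ≤ κ p q a b) ∧ (∀ a, ∑ b, κ p q a b = 1) ∧
      (∀ b, ∑ a, p a * κ p q a b = q b) ∧
      ∑ a, p a * (1 - κ p q a a) ≤ ∑ a, |p a - q a| := by
  suffices h : ∀ p q : C → ℝ, ∃ κ : C → C → ℝ, (∀ a, 0 ≤ p a) → ∑ a, p a = 1 →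
      (∀ a, 0 ≤ q a) → ∑ a, q a = 1 →
      (∀ a b, 0 ≤ κ a b) ∧ (∀ a, ∑ b, κ a b = 1) ∧ (∀ b, ∑ a, p a * κ a b = q b) ∧
      ∑ a, p a * (1 - κ a a) ≤ ∑ a, |p a - q a| by
    choose κ hκ using h
    exact ⟨κ, hκ⟩
  intro p q
  -- Keep the color `a` with probability `stay a`, and otherwise choose a new one according to the
  -- normalized positive part of `q - p`.
  let stay : C → ℝ := fun a => if p a ≤ q a then 1 else q a / p a
  let s : ℝ := ∑ a, max (q a - p a) 0
  let r : C → ℝ := fun b => max (q b - p b) 0 / s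
  refine ⟨fun a b => (if a = b then stay a else 0) + (1 - stay a) * r b, fun hp hp1 hq hq1 => ?_⟩
  have hs0 : 0 ≤ s := Finset.sum_nonneg fun a _ => le_max_right _ _
  have hr0 : ∀ b, 0 ≤ r b := fun b => div_nonneg (le_max_right _ _) hs0
  have hstay0 : ∀ a, 0 ≤ stay a := by
    intro a
    simp only [stay]
    split_ifs
    · exact zero_le_one
    · exact div_nonneg (hq a) (hp a)
  have hstay1 : ∀ a, stay a ≤ 1 := by
    intro a
    simp only [stay]
    split_ifs with h
    · exact le_rfl
    · have h := not_le.1 h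
      rw [div_le_one ((hq a).trans_lt h)]
      exact h.le
  have hmove : ∀ a, p a * (1 - stay a) = max (p a - q a) 0 := by
    intro a
    simp only [stay]
    split_ifs with h
    · rw [max_eq_right (by linarith)]; ring
    · have h := not_le.1 h
      have : p a ≠ 0 := ((hq a).trans_lt h).ne'
      rw [max_eq_left (by linarith)]
      field_simp
  have hs : ∑ a, max (p a - q a) 0 = s := by
    have : ∀ a, max (p a - q a) 0 - max (q a - p a) 0 = p a - q a := by
      intro a
      rcases le_total (p a) (q a) with h | h
      · rw [max_eq_right (by linarith), max_eq_left (by linarith)]; ring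
      · rw [max_eq_left (by linarith), max_eq_right (by linarith)]; ring
    have h2 := Finset.sum_congr rfl fun a (_ : a ∈ Finset.univ) => this a
    rw [Finset.sum_sub_distrib, Finset.sum_sub_distrib, hp1, hq1] at h2
    simp only [s]
    linarith
  have hr : ∀ b, r b * s = max (q b - p b) 0 := by
    intro b
    rcases hs0.eq_or_lt with h | h
    · have := (Finset.sum_eq_zero_iff_of_nonneg fun a _ => le_max_right (q a - p a) 0).1 h.symm b
        (Finset.mem_univ b)
      rw [← h, this, mul_zero]
    · exact div_mul_cancel₀ _ h.ne'
  have hrow : ∀ a, (1 - stay a) * ∑ b, r b = 1 - stay a := by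
    intro a
    rcases hs0.eq_or_lt with h | h
    · have := (Finset.sum_eq_zero_iff_of_nonneg fun a _ => le_max_right (p a - q a) 0).1
        (hs.trans h.symm) a (Finset.mem_univ a)
      have hle : p a ≤ q a := by linarith [le_max_left (p a - q a) 0]
      simp [stay, hle]
    · rw [← Finset.sum_div, div_self h.ne', mul_one]
  refine ⟨fun a b => ?_, fun a => ?_, fun b => ?_, ?_⟩
  · refine add_nonneg ?_ (mul_nonneg (by linarith [hstay1 a]) (hr0 b))
    split_ifs
    exacts [hstay0 a, le_rfl]
  · rw [Finset.sum_add_distrib, ← Finset.mul_sum, hrow]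
    simp
  · have h1 : ∀ a, p a * ((if a = b then stay a else 0) + (1 - stay a) * r b)
        = (if a = b then p a * stay a else 0) + max (p a - q a) 0 * r b := by
      intro a
      rw [← hmove a]
      split_ifs <;> ring
    simp only [h1]
    rw [Finset.sum_add_distrib, ← Finset.sum_mul, hs, mul_comm s, hr]
    simp only [Finset.sum_ite_eq', Finset.mem_univ, if_true]
    have := hmove b
    rcases le_total (p b) (q b) with h | h
    · rw [max_eq_right (by linarith)] at this
      rw [max_eq_left (by linarith)]; linarith
    · rw [max_eq_left (by linarith)] at this
      rw [max_eq_right (by linarith)]; linarith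
  · refine Finset.sum_le_sum fun a _ => ?_
    have h1 : p a * (1 - ((if a = a then stay a else 0) + (1 - stay a) * r a))
        ≤ p a * (1 - stay a) := by
      rw [if_pos rfl]
      refine mul_le_mul_of_nonneg_left ?_ (hp a)
      nlinarith [hstay1 a, hr0 a]
    refine h1.trans ?_
    rw [hmove]
    exact max_le (le_abs_self _) (abs_nonneg _)

/-! ### Random responses to the facet colors -/

section Response

variable {J : Type*} [Fintype J] [DecidableEq J] {Ω : J → Type*} [∀ j, Fintype (Ω j)]
  {C : Type*} [Fintype C] [DecidableEq C] {w : ∀ j, Ω j → ℝ} {c : Finset J → (∀ j, Ω j) → C}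
  {m m' : ℕ} {B : Finset J → J → (∀ j, Ω j) → Fin m} {B' : Finset J → J → (∀ j, Ω j) → Fin m'}

/-- The color of an edge `e` is reproduced, up to a small error, by a random *response function*,
which assigns a color to each possible facet type of the edge: the response to the actual facet
type is coupled with the actual color, while all the other responses are independent of it. The law
`V x` of the response function given the edge differs from a fixed law `π` by a uniform function,
since the coupling is done with the conditional probabilities for the fine partition `B'`. -/
theorem exists_response (hw : IsProb w) (hc : ∀ e, DependsOn (c e) (e : Set J))
    (hB' : IsFacetColoring B') (hR : Refines B' B) {ζ : ℝ}
    (hU : IsUniformPartition w c B' ζ) {T : Type*} [Fintype T] [DecidableEq T]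
    (E : (J → Fin m) ≃ T) (e : Finset J) :
    ∃ (π : (T → C) → ℝ) (V : (∀ j, Ω j) → (T → C) → ℝ),
      (∀ b, 0 ≤ π b) ∧ ∑ b, π b = 1 ∧ (∀ x b, 0 ≤ V x b) ∧ (∀ x, ∑ b, V x b = 1) ∧
      DependsOn V (e : Set J) ∧
      (∀ b, IsUniform w e (fun x => V x b - π b) (Fintype.card C * ζ)) ∧
      (expect w fun x => ∑ b, V x b * if b (E (facetType B e x)) = c e x then 0 else 1) ≤
        expect w fun x => ∑ a, |colorProb w c B' e (facetType B' e x) a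
          - colorProb w c B e (facetType B e x) a| := by
  obtain ⟨κ, hκ⟩ := exists_coupling C
  let p : (∀ j, Ω j) → C → ℝ := fun x => colorProb w c B' e (facetType B' e x)
  let q : T → C → ℝ := fun t => colorProb w c B e (E.symm t)
  let τ : (∀ j, Ω j) → T := fun x => E (facetType B e x)
  have hq : IsProb (Ω := fun _ : T => C) q :=
    ⟨fun t a => colorProb_nonneg hw _ _ _, fun t => sum_colorProb hw _ _⟩
  have hκ' : ∀ x, _ := fun x => hκ (p x) (q (τ x)) (fun a => colorProb_nonneg hw _ _ _)
    (sum_colorProb hw _ _) (fun a => hq.nonneg _ a) (hq.sum_eq_one _)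
  -- The laws of the responses to the various facet types, given the actual color `a`.
  let y : (∀ j, Ω j) → C → T → C → ℝ := fun x a =>
    Function.update q (τ x) (κ (p x) (q (τ x)) a)
  have hy : ∀ x a, IsProb (Ω := fun _ : T => C) (y x a) := by
    intro x a
    refine ⟨fun t b => ?_, fun t => ?_⟩ <;> by_cases ht : t = τ x
    · subst ht; simpa [y] using (hκ' x).1 a b
    · simpa [y, ht] using hq.nonneg t b
    · subst ht; simpa [y] using (hκ' x).2.1 a
    · simpa [y, ht] using hq.sum_eq_one t
  let φ : C → (T → C) → (∀ j, Ω j) → ℝ := fun a b x => ∏ t, y x a t (b t)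
  have hφ0 : ∀ a b x, 0 ≤ φ a b x := fun a b x => prod_weight_nonneg (hy x a) b
  have hφsum : ∀ a x, ∑ b, φ a b x = 1 := by
    intro a x
    have := expect_one (hy x a)
    simpa [expect] using this
  have hφ1 : ∀ a b x, φ a b x ≤ 1 := by
    intro a b x
    rw [← hφsum a x]
    exact Finset.single_le_sum (f := fun b => φ a b x) (fun b _ => hφ0 a b x) (Finset.mem_univ b)
  have hφB : ∀ a b, (φ a b).FactorsThrough (facetType B' e) := by
    intro a b x x' hxx
    have h1 : τ x = τ x' := congrArg E (hR.facetType e hxx)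
    have h2 : p x = p x' := by simp only [p, hxx]
    simp only [φ, y, h1, h2]
  refine ⟨fun b => ∏ t, q t (b t), fun x b => φ (c e x) b x, prod_weight_nonneg hq, ?_,
    fun x b => hφ0 _ b x, fun x => hφsum _ x, ?_, fun b => ?_, ?_⟩
  · have := expect_one hq
    simpa [expect] using this
  · intro x x' hxx
    funext b
    have h1 : c e x = c e x' := hc e hxx
    have h2 := hφB (c e x) b (hB'.dependsOn_facetType e hxx)
    rw [h1] at h2
    simpa only [h1] using h2
  · have hsum : (fun x => φ (c e x) b x - ∏ t, q t (b t)) = fun x =>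
        ∑ a, (colorInd (c e) a x - colorProb w c B' e (facetType B' e x) a) * φ a b x := by
      funext x
      simp only [sub_mul, Finset.sum_sub_distrib]
      congr 1
      · simp [colorInd]
      · have h1 : ∀ a, φ a b x
            = κ (p x) (q (τ x)) a (b (τ x)) * ∏ t ∈ Finset.univ.erase (τ x), q t (b t) := by
          intro a
          simp only [φ]
          rw [← Finset.mul_prod_erase _ _ (Finset.mem_univ (τ x))]
          congr 1
          · simp [y]
          · refine Finset.prod_congr rfl fun t ht => ?_
            simp [y, Finset.ne_of_mem_erase ht]
        simp only [h1, ← mul_assoc]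
        rw [← Finset.sum_mul, ← Finset.mul_prod_erase _ _ (Finset.mem_univ (τ x))]
        congr 1
        exact ((hκ' x).2.2.1 (b (τ x))).symm
    rw [hsum]
    have := IsUniform.sum (w := w) (e := e) Finset.univ
      (fun a _ => hU e a (φ a b) (hφB a b) fun x => ⟨hφ0 a b x, hφ1 a b x⟩)
    simpa using this
  · have h1 : ∀ x, ∑ b, φ (c e x) b x * (if b (E (facetType B e x)) = c e x then 0 else 1)
        = ∑ a, colorInd (c e) a x * (1 - κ (p x) (q (τ x)) a a) := by
      intro x
      have h2 := expect_eval (hy x (c e x)) (τ x) fun b => if b = c e x then 0 else 1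
      have h3 : y x (c e x) (τ x) = κ (p x) (q (τ x)) (c e x) := by simp [y]
      have h4 : ∀ b, κ (p x) (q (τ x)) (c e x) b * (if b = c e x then (0 : ℝ) else 1)
          = κ (p x) (q (τ x)) (c e x) b
            - if b = c e x then κ (p x) (q (τ x)) (c e x) b else 0 := by
        intro b; split_ifs <;> simp
      rw [h3] at h2
      simp only [h4, Finset.sum_sub_distrib, (hκ' x).2.1, Finset.sum_ite_eq', Finset.mem_univ,
        if_true] at h2
      simp only [expect] at h2
      refine Eq.trans h2 ?_
      simp [colorInd]
    simp only [h1]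
    have h5 : ∀ a, expect w (fun x => colorInd (c e) a x * (1 - κ (p x) (q (τ x)) a a))
        = expect w fun x => p x a * (1 - κ (p x) (q (τ x)) a a) := by
      intro a
      refine (expect_fiberMean_mul (τ := facetType B' e) hw fun x x' hxx => ?_).symm
      have h1 : τ x = τ x' := congrArg E (hR.facetType e hxx)
      have h2 : p x = p x' := by simp only [p, hxx]
      simp only [h1, h2]
    rw [expect_finset_sum, Finset.sum_congr rfl fun a _ => h5 a, ← expect_finset_sum]
    refine expect_mono hw fun x => ?_
    have := (hκ' x).2.2.2
    simpa [p, q, τ] using this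

end Response

/-! ### Approximation of colorings by independent random colors -/

section Model

variable {J : Type*} [Fintype J] [DecidableEq J] {Ω : J → Type*} [∀ j, Fintype (Ω j)]

/-- A random model of the colorings `c` up to edge size `k`: given the point `x`, all edges `f`
receive independent random colors in `K` with laws `kernel x f`, which depend only on the vertices
of `f` and are, up to an `η`-uniform error, the fixed laws `law f`. The color of an edge `e` with
at most `k` vertices is a function of the random colors of its subsets, with error probability at
most `δ`. -/
structure RandomModel {C : Type*} [DecidableEq C] (w : ∀ j, Ω j → ℝ)
    (c : Finset J → (∀ j, Ω j) → C) (k : ℕ) (δ η : ℝ) (K : Type*) [Fintype K] where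
  law : Finset J → K → ℝ
  kernel : (∀ j, Ω j) → Finset J → K → ℝ
  decode : Finset J → (Finset J → K) → C
  isProb_law : IsProb (Ω := fun _ => K) law
  isProb_kernel : ∀ x, IsProb (Ω := fun _ => K) (kernel x)
  dependsOn_kernel : ∀ e, DependsOn (fun x => kernel x e) (e : Set J)
  isUniform : ∀ e a, IsUniform w e (fun x => kernel x e a - law e a) η
  kernel_eq_law : ∀ e, k < e.card → ∀ x, kernel x e = law e
  dependsOn_decode : ∀ e, DependsOn (decode e) {f | f ⊆ e}
  error_le : ∀ e, e.card ≤ k →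
    (expect w fun x => expect (Ω := fun _ => K) (kernel x) fun a =>
      if decode e a = c e x then 0 else 1) ≤ δ

/-- The empty edge needs no random color at all. -/
theorem nonempty_randomModel_zero {C : Type*} [DecidableEq C] {w : ∀ j, Ω j → ℝ} (hw : IsProb w)
    {c : Finset J → (∀ j, Ω j) → C} (hc : ∀ e, DependsOn (c e) (e : Set J)) {δ η : ℝ} (hδ : 0 ≤ δ)
    (hη : 0 ≤ η) : Nonempty (RandomModel w c 0 δ η Unit) := by
  obtain ⟨x₀⟩ := hw.nonempty
  have h1 : IsProb (J := Finset J) (Ω := fun _ => Unit) fun _ _ => 1 :=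
    ⟨fun _ _ => zero_le_one, fun _ => by simp⟩
  exact ⟨{
    law := fun _ _ => 1
    kernel := fun _ _ _ => 1
    decode := fun e _ => c e x₀
    isProb_law := h1
    isProb_kernel := fun _ => h1
    dependsOn_kernel := fun _ _ _ _ => rfl
    isUniform := fun e a => by simpa using isUniform_zero hη
    kernel_eq_law := fun _ _ _ => rfl
    dependsOn_decode := fun _ _ _ _ => rfl
    error_le := fun e he => by
      have he' : e = ∅ := Finset.card_eq_zero.1 (Nat.le_zero.1 he)
      have h : ∀ x, (if c e x₀ = c e x then (0 : ℝ) else 1) = 0 :=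
        fun x => if_pos (hc e (by simp [he']))
      simpa only [h, expect, mul_zero, Finset.sum_const_zero] using hδ }⟩

variable {C : Type*} [Fintype C] [DecidableEq C] {w : ∀ j, Ω j → ℝ}
  {c : Finset J → (∀ j, Ω j) → C} {m m' n : ℕ} {B : Finset J → J → (∀ j, Ω j) → Fin m}
  {B' : Finset J → J → (∀ j, Ω j) → Fin m'}

theorem expect_fst {K N : Type*} [Fintype K] [Fintype N] {U : Finset J → K → ℝ}
    {V : Finset J → N → ℝ} (hV : IsProb (Ω := fun _ => N) V) (G : (Finset J → K) → ℝ) :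
    expect (Ω := fun _ => K × N) (fun f a => U f a.1 * V f a.2) (fun a => G fun f => (a f).1) =
      expect (Ω := fun _ => K) U G := by
  classical
  rw [expect_map (Ω := fun _ => K × N) (Ω' := fun _ => K) (fun _ a => a.1) G]
  congr 1
  funext f b
  have : (Finset.univ.filter fun a : K × N => a.1 = b) = ({b} : Finset K) ×ˢ Finset.univ := by
    ext ⟨a, a'⟩; simp [eq_comm]
  rw [this, Finset.sum_product]
  simp [← Finset.mul_sum, hV.sum_eq_one]

theorem expect_snd {K N : Type*} [Fintype K] [Fintype N] {U : Finset J → K → ℝ}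
    {V : Finset J → N → ℝ} (hU : IsProb (Ω := fun _ => K) U) (G : (Finset J → N) → ℝ) :
    expect (Ω := fun _ => K × N) (fun f a => U f a.1 * V f a.2) (fun a => G fun f => (a f).2) =
      expect (Ω := fun _ => N) V G := by
  classical
  rw [expect_map (Ω := fun _ => K × N) (Ω' := fun _ => N) (fun _ a => a.2) G]
  congr 1
  funext f b
  have : (Finset.univ.filter fun a : K × N => a.2 = b) = Finset.univ ×ˢ ({b} : Finset N) := by
    ext ⟨a, a'⟩; simp [eq_comm]
  rw [this, Finset.sum_product]
  simp [← Finset.sum_mul, hU.sum_eq_one]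

/-- A random model up to edge size `k` for the colors together with the coarse facet colors extends
to a random model for the colors up to edge size `k + 1`: the new random color of an edge of size
`k + 1` is its response function. -/
theorem RandomModel.nonempty_extend (hw : IsProb w) (hc : ∀ e, DependsOn (c e) (e : Set J))
    (hB : IsFacetColoring B) (hB' : IsFacetColoring B') (hR : Refines B' B) {ζ : ℝ}
    (hU : IsUniformPartition w c B' ζ) (ι : J ≃ Fin n) {k : ℕ} {K : Type*} [Fintype K]
    {δ δ' η : ℝ} (hζη : Fintype.card C * ζ ≤ η) (hδ'0 : 0 ≤ δ')
    (hδδ' : n * δ' ≤ δ / 2)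
    (hδ'δ : δ' ≤ δ)
    (hσ : ∀ e, (expect w fun x => ∑ a, |colorProb w c B' e (facetType B' e x) a
      - colorProb w c B e (facetType B e x) a|) ≤ δ / 2)
    (M : RandomModel w (fun f x => ((c f x, fun i => B (insert (ι.symm i) f) (ι.symm i) x) :
      C × (Fin n → Fin m))) k δ' η K) :
    Nonempty (RandomModel w c (k + 1) δ η (K × ((Fin n → Fin m) → C))) := by
  let E : (J → Fin m) ≃ (Fin n → Fin m) := ι.arrowCongr (Equiv.refl _)
  obtain ⟨x₀⟩ := hw.nonempty
  let d : (Fin n → Fin m) → C := fun _ => c ∅ x₀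
  choose π V hπ0 hπ1 hV0 hV1 hVd hVU hVerr using fun e =>
    exists_response hw hc hB' hR hU E e
  let π' : Finset J → ((Fin n → Fin m) → C) → ℝ := fun e b =>
    if e.card = k + 1 then π e b else if b = d then 1 else 0
  let V' : (∀ j, Ω j) → Finset J → ((Fin n → Fin m) → C) → ℝ := fun x e b =>
    if e.card = k + 1 then V e x b else if b = d then 1 else 0
  have hπ' : IsProb (Ω := fun _ => (Fin n → Fin m) → C) π' := by
    refine ⟨fun e b => ?_, fun e => ?_⟩ <;> by_cases he : e.card = k + 1
    · simpa [π', he] using hπ0 e b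
    · simp only [π', he, if_false]; split_ifs <;> simp
    · simpa [π', he] using hπ1 e
    · simp [π', he]
  have hV' : ∀ x, IsProb (Ω := fun _ => (Fin n → Fin m) → C) (V' x) := by
    intro x
    refine ⟨fun e b => ?_, fun e => ?_⟩ <;> by_cases he : e.card = k + 1
    · simpa [V', he] using hV0 e x b
    · simp only [V', he, if_false]; split_ifs <;> simp
    · simpa [V', he] using hV1 e x
    · simp [V', he]
  have hprod : ∀ {U : Finset J → K → ℝ} {V : Finset J → ((Fin n → Fin m) → C) → ℝ},
      IsProb (Ω := fun _ => K) U → IsProb (Ω := fun _ => (Fin n → Fin m) → C) V →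
      IsProb (Ω := fun _ => K × ((Fin n → Fin m) → C)) fun f a => U f a.1 * V f a.2 := by
    intro U V hU hV
    refine ⟨fun f a => mul_nonneg (hU.nonneg _ _) (hV.nonneg _ _), fun f => ?_⟩
    rw [Fintype.sum_prod_type]
    simp [← Finset.mul_sum, hV.sum_eq_one, hU.sum_eq_one]
  have hle1 : ∀ {N : Type _} [Fintype N] {U : Finset J → N → ℝ}, IsProb (Ω := fun _ => N) U →
      ∀ f a, |U f a| ≤ 1 := by
    intro N _ U hU f a
    rw [abs_of_nonneg (hU.nonneg f a), ← hU.sum_eq_one f]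
    exact Finset.single_le_sum (fun a _ => hU.nonneg f a) (Finset.mem_univ a)
  refine ⟨{
    law := fun e a => M.law e a.1 * π' e a.2
    kernel := fun x e a => M.kernel x e a.1 * V' x e a.2
    decode := fun e a =>
      if e.card = k + 1 then
        (a e).2 fun i => if ι.symm i ∈ e then
          (M.decode (e.erase (ι.symm i)) fun f => (a f).1).2 i else B e (ι.symm i) x₀
      else (M.decode e fun f => (a f).1).1
    isProb_law := hprod M.isProb_law hπ'
    isProb_kernel := fun x => hprod (M.isProb_kernel x) (hV' x)
    dependsOn_kernel := ?_
    isUniform := ?_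
    kernel_eq_law := ?_
    dependsOn_decode := ?_
    error_le := ?_ }⟩
  · intro e x y hxy
    have h1 := M.dependsOn_kernel e hxy
    have h2 := hVd e hxy
    funext a
    simp only [V', h2]
    rw [show M.kernel x e = M.kernel y e from h1]
  · intro e a
    by_cases he : e.card = k + 1
    · have h1 : ∀ x, M.kernel x e = M.law e := M.kernel_eq_law e (by omega)
      simp only [V', π', he, h1, if_true, ← mul_sub]
      exact ((hVU e a.2).mono hζη).const_mul (hle1 M.isProb_law e a.1)
    · simp only [V', π', he, if_false]
      have := (M.isUniform e a.1).const_mul (a := if a.2 = d then 1 else 0)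
        (by split_ifs <;> simp)
      simpa only [← sub_mul, mul_comm] using this
  · intro e he x
    have h1 : M.kernel x e = M.law e := M.kernel_eq_law e (by omega) x
    have h2 : e.card ≠ k + 1 := by omega
    simp only [V', π', h1, h2, if_false]
  · intro e a b hab
    have hsub : ∀ g ⊆ e, (M.decode g fun f => (a f).1) = M.decode g fun f => (b f).1 :=
      fun g hg => M.dependsOn_decode g fun f hf => by
        rw [hab f (Finset.Subset.trans hf hg)]
    have h1 : a e = b e := hab e (Finset.Subset.refl e)
    simp only [h1, hsub e (Finset.Subset.refl e), hsub _ (Finset.erase_subset _ e)]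
  · intro e he
    by_cases hek : e.card = k + 1
    · simp only [hek, if_true]
      -- An error in the color of `e` comes from an error in a facet color or in the response.
      have hpt : ∀ x (a : Finset J → K × ((Fin n → Fin m) → C)),
          (if (a e).2 (fun i => if ι.symm i ∈ e then
              (M.decode (e.erase (ι.symm i)) fun f => (a f).1).2 i else B e (ι.symm i) x₀) = c e x
            then (0 : ℝ) else 1) ≤
          (∑ j ∈ e, if M.decode (e.erase j) (fun f => (a f).1) = (c (e.erase j) x,
              fun i => B (insert (ι.symm i) (e.erase j)) (ι.symm i) x) then (0 : ℝ) else 1) +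
            if (a e).2 (E (facetType B e x)) = c e x then 0 else 1 := by
        intro x a
        have hnn : ∀ j ∈ e, (0 : ℝ) ≤ if M.decode (e.erase j) (fun f => (a f).1) =
            (c (e.erase j) x, fun i => B (insert (ι.symm i) (e.erase j)) (ι.symm i) x)
            then (0 : ℝ) else 1 := fun j _ => by split_ifs <;> simp
        by_cases hall : ∀ j ∈ e, M.decode (e.erase j) (fun f => (a f).1) =
            (c (e.erase j) x, fun i => B (insert (ι.symm i) (e.erase j)) (ι.symm i) x)
        · have heq : (fun i => if ι.symm i ∈ e then
              (M.decode (e.erase (ι.symm i)) fun f => (a f).1).2 i else B e (ι.symm i) x₀)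
              = E (facetType B e x) := by
            funext i
            have hE : E (facetType B e x) i = B e (ι.symm i) x := rfl
            rw [hE]
            split_ifs with hi
            · rw [hall _ hi]
              change B (insert (ι.symm i) (e.erase (ι.symm i))) (ι.symm i) x = _
              rw [Finset.insert_erase hi]
            · exact hB e (ι.symm i) fun l hl => absurd hl.1 hi
          rw [heq]
          exact le_add_of_nonneg_left (Finset.sum_nonneg hnn)
        · push Not at hall
          obtain ⟨j, hj, hne⟩ := hall
          have h1 := Finset.single_le_sum hnn hj
          rw [if_neg hne] at h1
          have h2 : (0 : ℝ) ≤ if (a e).2 (E (facetType B e x)) = c e x then 0 else 1 := by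
            split_ifs <;> simp
          refine le_trans ?_ (h1.trans (le_add_of_nonneg_right h2))
          split_ifs <;> simp
      have hx : ∀ x, expect (Ω := fun _ => K × ((Fin n → Fin m) → C))
          (fun f a => M.kernel x f a.1 * V' x f a.2) (fun a =>
            if (a e).2 (fun i => if ι.symm i ∈ e then
              (M.decode (e.erase (ι.symm i)) fun f => (a f).1).2 i else B e (ι.symm i) x₀) = c e x
            then (0 : ℝ) else 1) ≤
          (∑ j ∈ e, expect (Ω := fun _ => K) (M.kernel x) fun a =>
            if M.decode (e.erase j) a = (c (e.erase j) x,
              fun i => B (insert (ι.symm i) (e.erase j)) (ι.symm i) x) then (0 : ℝ) else 1) +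
            ∑ b, V e x b * if b (E (facetType B e x)) = c e x then 0 else 1 := by
        intro x
        refine (expect_mono (hprod (M.isProb_kernel x) (hV' x)) (hpt x)).trans_eq ?_
        rw [expect_add, expect_finset_sum]
        congr 1
        · exact Finset.sum_congr rfl fun j _ => expect_fst (hV' x) fun a =>
            if M.decode (e.erase j) a = (c (e.erase j) x,
              fun i => B (insert (ι.symm i) (e.erase j)) (ι.symm i) x) then (0 : ℝ) else 1
        · rw [expect_snd (M.isProb_kernel x) fun a : Finset J → (Fin n → Fin m) → C =>
            if a e (E (facetType B e x)) = c e x then (0 : ℝ) else 1]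
          rw [expect_eval (hV' x) e fun b => if b (E (facetType B e x)) = c e x then (0 : ℝ) else 1]
          simp [V', hek]
      refine (expect_mono hw hx).trans ?_
      rw [expect_add, expect_finset_sum]
      have h1 : ∀ j ∈ e, (expect w fun x => expect (Ω := fun _ => K) (M.kernel x) fun a =>
            if M.decode (e.erase j) a = (c (e.erase j) x,
              fun i => B (insert (ι.symm i) (e.erase j)) (ι.symm i) x) then (0 : ℝ) else 1) ≤ δ' :=
        fun j hj => M.error_le _ (by rw [Finset.card_erase_of_mem hj]; omega)
      have h2 := (hVerr e).trans (hσ e)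
      have h3 : (e.card : ℝ) ≤ n := by
        have := Finset.card_le_univ e
        rw [Fintype.card_congr ι, Fintype.card_fin] at this
        exact_mod_cast this
      have h4 := Finset.sum_le_sum h1
      rw [Finset.sum_const, nsmul_eq_mul] at h4
      have h5 : (e.card : ℝ) * δ' ≤ n * δ' := mul_le_mul_of_nonneg_right h3 hδ'0
      linarith
    · have he' : e.card ≤ k := by omega
      simp only [hek, if_false]
      have h1 := M.error_le e he'
      refine le_trans ?_ (h1.trans hδ'δ)
      refine expect_mono hw fun x => ?_
      rw [expect_fst (hV' x) fun a => if (M.decode e a).1 = c e x then (0 : ℝ) else 1]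
      refine expect_mono (M.isProb_kernel x) fun a => ?_
      by_cases h : M.decode e a = (c e x, fun i => B (insert (ι.symm i) e) (ι.symm i) x)
      · simp [h]
      · rw [if_neg h]
        split_ifs <;> simp

end Model

theorem exists_pos_forall_le (f : ℕ → ℝ) (hf : ∀ t, 0 < f t) (M : ℕ) :
    ∃ z : ℝ, 0 < z ∧ ∀ t ≤ M, z ≤ f t := by
  obtain ⟨t₀, -, ht₀⟩ := Finset.exists_min_image (Finset.range (M + 1)) f ⟨0, by simp⟩
  exact ⟨f t₀, hf t₀, fun t ht => ht₀ t (Finset.mem_range.2 (Nat.lt_succ_of_le ht))⟩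

/-- All colorings have random models with a bounded number of random colors, for any prescribed
uniformity in terms of that number. -/
theorem exists_randomModel (n k : ℕ) : ∀ (C : Type) [Fintype C] [DecidableEq C] (δ : ℝ), 0 < δ →
    ∀ η : ℕ → ℝ, (∀ t, 0 < η t) → ∃ M : ℕ, ∀ (J : Type u) [Fintype J] [DecidableEq J],
      Fintype.card J = n → ∀ (Ω : J → Type v) [∀ j, Fintype (Ω j)] (w : ∀ j, Ω j → ℝ), IsProb w →
      ∀ c : Finset J → (∀ j, Ω j) → C, (∀ e, DependsOn (c e) (e : Set J)) →
      ∃ (K : Type) (_ : Fintype K), Fintype.card K ≤ M ∧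
        Nonempty (RandomModel w c k δ (η (Fintype.card K)) K) := by
  induction k with
  | zero =>
    intro C _ _ δ hδ η hη
    refine ⟨1, ?_⟩
    intro J _ _ hJ Ω _ w hw c hc
    exact ⟨Unit, inferInstance, by simp, nonempty_randomModel_zero hw hc hδ.le (hη _).le⟩
  | succ k ih =>
    intro C _ _ δ hδ η hη
    let N : ℕ → ℕ := fun m => Fintype.card ((Fin n → Fin m) → C)
    have hδ' : 0 < δ / (2 * (n + 1)) := by positivity
    have ih' := fun m : ℕ => ih (C × (Fin n → Fin m)) (δ / (2 * (n + 1))) hδ'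
      (fun t => η (t * N m)) fun t => hη _
    choose M₁ hM₁ using ih'
    choose z hz0 hz using fun m => exists_pos_forall_le (fun t => η (t * N m)) (fun t => hη _) (M₁ m)
    -- The fine partition has to be uniform relative to all the random colors that the coarse
    -- facet colors will need.
    obtain ⟨M₂, hM₂⟩ := exists_coarse_fine_partition.{u, v} n C (half_pos hδ)
      (fun m => z m / (Fintype.card C + 1)) fun m => div_pos (hz0 m) (by positivity)
    refine ⟨(Finset.range (M₂ + 1)).sup fun m => M₁ m * N m, ?_⟩
    intro J _ _ hJ Ω _ w hw c hc
    obtain ⟨m, hm, B, hB, m', B', hB', hR, hU, hσ⟩ := hM₂ J hJ Ω w hw c hc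
    let ι : J ≃ Fin n := Fintype.equivFinOfCardEq hJ
    obtain ⟨K, hK, hKM, ⟨R⟩⟩ := hM₁ m J hJ Ω w hw
      (fun f x => (c f x, fun i => B (insert (ι.symm i) f) (ι.symm i) x)) (by
        intro f x y hxy
        refine Prod.ext (hc f hxy) (funext fun i => hB _ _ fun l hl => hxy l ?_)
        exact Finset.mem_of_mem_insert_of_ne hl.2.1 hl.2.2)
    have hcard : Fintype.card (K × ((Fin n → Fin m) → C)) = Fintype.card K * N m :=
      Fintype.card_prod _ _
    refine ⟨K × ((Fin n → Fin m) → C), inferInstance, ?_, ?_⟩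
    · rw [hcard]
      refine (Nat.mul_le_mul_right _ hKM).trans ?_
      exact Finset.le_sup (f := fun m => M₁ m * N m) (Finset.mem_range.2 (Nat.lt_succ_of_le hm))
    · rw [hcard]
      refine R.nonempty_extend hw hc hB hB' hR hU ι ?_ hδ'.le ?_ ?_ hσ
      · refine le_trans ?_ (hz m _ hKM)
        rw [mul_div_assoc', div_le_iff₀ (by positivity)]
        nlinarith [hz0 m]
      · rw [mul_div_assoc', div_le_div_iff₀ (by positivity) (by positivity)]
        nlinarith
      · refine div_le_self hδ.le ?_
        have : (0 : ℝ) ≤ n := Nat.cast_nonneg n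
        linarith
/-! ### Counting -/

section Counting

variable {J : Type*} [Fintype J] [DecidableEq J] {Ω : J → Type*} [∀ j, Fintype (Ω j)]
  {C : Type*} [DecidableEq C] {w : ∀ j, Ω j → ℝ} {c : Finset J → (∀ j, Ω j) → C} {k : ℕ} {δ η : ℝ}
  {K : Type*} [Fintype K]

theorem RandomModel.kernel_mem (M : RandomModel w c k δ η K) (x : ∀ j, Ω j) (f : Finset J) (b : K) :
    0 ≤ M.kernel x f b ∧ M.kernel x f b ≤ 1 := by
  refine ⟨(M.isProb_kernel x).nonneg f b, ?_⟩
  rw [← (M.isProb_kernel x).sum_eq_one f]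
  exact Finset.single_le_sum (fun b _ => (M.isProb_kernel x).nonneg f b) (Finset.mem_univ b)

theorem RandomModel.law_mem (M : RandomModel w c k δ η K) (f : Finset J) (b : K) :
    0 ≤ M.law f b ∧ M.law f b ≤ 1 := by
  refine ⟨M.isProb_law.nonneg f b, ?_⟩
  rw [← M.isProb_law.sum_eq_one f]
  exact Finset.single_le_sum (fun b _ => M.isProb_law.nonneg f b) (Finset.mem_univ b)

theorem RandomModel.prod_kernel_mem (M : RandomModel w c k δ η K) (x : ∀ j, Ω j)
    (s : Finset (Finset J)) (a : Finset J → K) :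
    0 ≤ ∏ f ∈ s, M.kernel x f (a f) ∧ ∏ f ∈ s, M.kernel x f (a f) ≤ 1 :=
  ⟨Finset.prod_nonneg fun f _ => (M.kernel_mem x f _).1,
    Finset.prod_le_one (fun f _ => (M.kernel_mem x f _).1) fun f _ => (M.kernel_mem x f _).2⟩

theorem RandomModel.abs_expect_kernel_sub_law_le (M : RandomModel w c k δ η K) (hw : IsProb w)
    (f : Finset J) (b : K) : |expect w (fun x => M.kernel x f b) - M.law f b| ≤ η := by
  have h := M.isUniform f b (fun _ _ => 1) (by simp) fun _ _ _ _ _ => rfl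
  simp only [Finset.prod_const_one, mul_one] at h
  rwa [expect_sub, expect_const hw] at h

/-- The counting lemma: the random colors of edges `f` that are not contained in `e` are independent
of any function `F` of the vertices of `e`. The kernels are replaced by the laws one by one, in the
order of decreasing size of `f`, so that all other factors miss a vertex of `f`. -/
theorem RandomModel.abs_expect_mul_prod_kernel_sub_le (M : RandomModel w c k δ η K)
    {F : (∀ j, Ω j) → ℝ} {e : Finset J} (hF : ∀ x, 0 ≤ F x ∧ F x ≤ 1)
    (hFe : DependsOn F (e : Set J)) (a : Finset J → K) (s : Finset (Finset J))
    (hs : ∀ f ∈ s, ¬ f ⊆ e) :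
    |expect w (fun x => F x * ∏ f ∈ s, M.kernel x f (a f))
      - expect w F * ∏ f ∈ s, M.law f (a f)| ≤ s.card * η := by
  classical
  revert hs
  refine Finset.induction_on_max_value (fun f : Finset J => f.card) s ?_ ?_
  · intro _
    simp
  · intro f s hfs hmax ih hs
    have ih := ih fun g hg => hs g (Finset.mem_insert_of_mem hg)
    have hmiss : ∀ g : Finset J, ¬ f ⊆ g → ∃ j ∈ f, (g : Set J) ⊆ {j}ᶜ := by
      intro g hfg
      obtain ⟨j, hjf, hjg⟩ := Finset.not_subset.1 hfg
      exact ⟨j, hjf, fun i hi => by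
        rintro rfl
        exact hjg hi⟩
    have huni := (M.isUniform f (a f)).abs_expect_mul_prod_le (Finset.insertNone s)
      (u := fun (o : Option (Finset J)) x => o.elim (F x) fun g => M.kernel x g (a g))
      (by
        rintro (_ | g) _ x
        · exact hF x
        · exact M.kernel_mem x g _)
      (by
        rintro (_ | g) hg
        · obtain ⟨j, hj, hje⟩ := hmiss e (hs f (Finset.mem_insert_self f s))
          exact ⟨j, hj, hFe.mono hje⟩
        · have hg := Finset.some_mem_insertNone.1 hg
          have hne : ¬ f ⊆ g := fun h => by
            have := Finset.eq_of_subset_of_card_le h (hmax g hg)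
            exact hfs (this ▸ hg)
          obtain ⟨j, hj, hje⟩ := hmiss g hne
          refine ⟨j, hj, fun x y hxy => ?_⟩
          have := (M.dependsOn_kernel g).mono hje hxy
          exact congrFun this (a g))
    simp only [Finset.prod_insertNone, Option.elim_none, Option.elim_some] at huni
    have h1 : (fun x => F x * ∏ g ∈ insert f s, M.kernel x g (a g)) = fun x =>
        (M.kernel x f (a f) - M.law f (a f)) * (F x * ∏ g ∈ s, M.kernel x g (a g)) +
        M.law f (a f) * (F x * ∏ g ∈ s, M.kernel x g (a g)) := by
      funext x
      rw [Finset.prod_insert hfs]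
      ring
    rw [h1, expect_add, expect_const_mul, Finset.prod_insert hfs, Finset.card_insert_of_notMem hfs]
    have hl := M.law_mem f (a f)
    set X := expect w fun x => (M.kernel x f (a f) - M.law f (a f)) *
      (F x * ∏ g ∈ s, M.kernel x g (a g))
    set Y := expect w fun x => F x * ∏ g ∈ s, M.kernel x g (a g)
    set Q := ∏ g ∈ s, M.law g (a g)
    calc |X + M.law f (a f) * Y - expect w F * (M.law f (a f) * Q)|
        = |X + M.law f (a f) * (Y - expect w F * Q)| := by congr 1; ring
      _ ≤ |X| + |M.law f (a f) * (Y - expect w F * Q)| := abs_add_le _ _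
      _ ≤ η + 1 * (s.card * η) := by
        rw [abs_mul, abs_of_nonneg hl.1]
        gcongr
        exact hl.2
      _ = _ := by push_cast; ring

theorem RandomModel.dependsOn_prod_kernel (M : RandomModel w c k δ η K) (e : Finset J)
    (a : Finset J → K) :
    DependsOn (fun x => ∏ f ∈ e.powerset, M.kernel x f (a f)) (e : Set J) := by
  intro x y hxy
  refine Finset.prod_congr rfl fun f hf => ?_
  have := M.dependsOn_kernel f fun j hj => hxy j (Finset.mem_powerset.1 hf hj)
  exact congrFun this (a f)

/-- The probability of the random colors `a` on a family of edges is at least the product of their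
laws, up to a small error. The kernel of the empty edge is a constant function of the point, and is
compared with its law after all the others. -/
theorem RandomModel.prod_law_le_expect (M : RandomModel w c k δ η K) (hw : IsProb w)
    (a : Finset J → K) (s : Finset (Finset J)) (hs : ∅ ∈ s) :
    ∏ f ∈ s, M.law f (a f) ≤ expect w (fun x => ∏ f ∈ s, M.kernel x f (a f)) + s.card * η := by
  have h1 := M.abs_expect_mul_prod_kernel_sub_le (F := fun x => M.kernel x ∅ (a ∅)) (e := ∅)
    (fun x => M.kernel_mem x _ _) (fun x y hxy => congrFun (M.dependsOn_kernel ∅ hxy) (a ∅)) a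
    (s.erase ∅) fun f hf h => Finset.ne_of_mem_erase hf (Finset.subset_empty.1 h)
  have h2 := M.abs_expect_kernel_sub_law_le hw ∅ (a ∅)
  rw [show (fun x => M.kernel x ∅ (a ∅) * ∏ f ∈ s.erase ∅, M.kernel x f (a f)) =
    fun x => ∏ f ∈ s, M.kernel x f (a f) from funext fun x =>
      Finset.mul_prod_erase s (fun f => M.kernel x f (a f)) hs] at h1
  rw [← Finset.mul_prod_erase s (fun f => M.law f (a f)) hs]
  have hQ0 : 0 ≤ ∏ f ∈ s.erase ∅, M.law f (a f) := Finset.prod_nonneg fun f _ => (M.law_mem f _).1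
  have hQ1 : ∏ f ∈ s.erase ∅, M.law f (a f) ≤ 1 :=
    Finset.prod_le_one (fun f _ => (M.law_mem f _).1) fun f _ => (M.law_mem f _).2
  have hc : (s.card : ℝ) = (s.erase ∅).card + 1 := by
    exact_mod_cast (Finset.card_erase_add_one hs).symm
  have h3 := (abs_le.1 h1).1
  have h4 := (abs_le.1 h2).1
  have hη : 0 ≤ η := (abs_nonneg _).trans h2
  rw [hc]
  nlinarith

end Counting

/-! ### Bad edges -/

section Bad

variable {J : Type*} [Fintype J] [DecidableEq J] {Ω : J → Type*} [∀ j, Fintype (Ω j)]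
  {C : Type*} [DecidableEq C] {w : ∀ j, Ω j → ℝ} {c : Finset J → (∀ j, Ω j) → C} {k : ℕ} {δ η : ℝ}
  {K : Type*} [Fintype K]

/-- The random colors `a` decode the color of the edge `e` of `x` incorrectly. -/
def RandomModel.decodeError (M : RandomModel w c k δ η K) (e : Finset J) (x : ∀ j, Ω j)
    (a : Finset J → K) : ℝ :=
  if M.decode e a = c e x then 0 else 1

/-- The likelihood of the random colors `a` on the subsets of `e`. -/
def RandomModel.likelihood (M : RandomModel w c k δ η K) (e : Finset J) (a : Finset J → K)
    (x : ∀ j, Ω j) : ℝ :=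
  ∏ f ∈ e.powerset, M.kernel x f (a f)

/-- The random colors `a` are atypical on `e`, given the thresholds `κ` and `θ`: one of them has a
law below `κ`, or, conditional on the random colors on `e`, the probability that the color of `e`
is decoded incorrectly exceeds `θ`. -/
def RandomModel.IsAtypical (M : RandomModel w c k δ η K) (κ θ : ℝ) (e : Finset J)
    (a : Finset J → K) : Prop :=
  (∃ f ∈ e.powerset, M.law f (a f) < κ) ∨
    θ * expect w (M.likelihood e a) <
      expect w fun x => M.decodeError e x a * M.likelihood e a x

open Classical in
/-- The probability, given `x`, that the random colors are decoded incorrectly or are atypical at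
the edge `e`. -/
noncomputable def RandomModel.badProb (M : RandomModel w c k δ η K) (κ θ : ℝ) (e : Finset J)
    (x : ∀ j, Ω j) : ℝ :=
  expect (Ω := fun _ => K) (M.kernel x) fun a =>
    if M.decode e a ≠ c e x ∨ M.IsAtypical κ θ e a then 1 else 0

variable (M : RandomModel w c k δ η K) {κ θ : ℝ} {e : Finset J}

theorem RandomModel.decodeError_mem (x : ∀ j, Ω j) (a : Finset J → K) :
    0 ≤ M.decodeError e x a ∧ M.decodeError e x a ≤ 1 := by
  unfold decodeError
  split_ifs <;> simp

theorem RandomModel.dependsOn_decodeError (x : ∀ j, Ω j) :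
    DependsOn (M.decodeError e x) (e.powerset : Set (Finset J)) := by
  intro a b hab
  have : M.decode e a = M.decode e b :=
    M.dependsOn_decode e fun f hf => hab f (Finset.mem_coe.2 (Finset.mem_powerset.2 hf))
  simp only [decodeError, this]

theorem RandomModel.dependsOn_likelihood :
    DependsOn (M.likelihood e) (e.powerset : Set (Finset J)) := by
  intro a b hab
  funext x
  exact Finset.prod_congr rfl fun f hf => by rw [hab f hf]

theorem RandomModel.dependsOn_isAtypical :
    DependsOn (M.IsAtypical κ θ e) (e.powerset : Set (Finset J)) := by
  intro a b hab
  have h1 : ∀ x, M.decodeError e x a = M.decodeError e x b := fun x => M.dependsOn_decodeError x hab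
  have h2 : M.likelihood e a = M.likelihood e b := M.dependsOn_likelihood hab
  have h3 : (∃ f ∈ e.powerset, M.law f (a f) < κ) ↔ ∃ f ∈ e.powerset, M.law f (b f) < κ :=
    exists_congr fun f => and_congr_right fun hf => by rw [hab f hf]
  simp only [IsAtypical, h1, h2, h3]

/-- Whether an edge is bad depends on its vertices only. -/
theorem RandomModel.dependsOn_badProb (hc : DependsOn (c e) (e : Set J)) :
    DependsOn (M.badProb κ θ e) (e : Set J) := by
  classical
  intro x y hxy
  have h1 : c e x = c e y := hc hxy
  unfold badProb
  rw [h1]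
  refine expect_congr_weight (M.isProb_kernel x) (M.isProb_kernel y) (S := e.powerset) ?_ ?_
  · intro f hf
    exact M.dependsOn_kernel f fun j hj => hxy j (Finset.mem_powerset.1 hf hj)
  · intro a b hab
    have h2 : M.decode e a = M.decode e b :=
      M.dependsOn_decode e fun f hf => hab f (Finset.mem_coe.2 (Finset.mem_powerset.2 hf))
    have h3 : M.IsAtypical κ θ e a = M.IsAtypical κ θ e b := M.dependsOn_isAtypical hab
    simp only [h2, h3]

open Classical in
/-- Markov's inequality for the conditional probability of a decoding error. -/
theorem RandomModel.mul_expect_decodeError_gt_le (hw : IsProb w) (he : e.card ≤ k) :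
    θ * (expect w fun x => expect (Ω := fun _ => K) (M.kernel x) fun a =>
      if θ * expect w (M.likelihood e a) < expect w fun x => M.decodeError e x a * M.likelihood e a x
      then 1 else 0) ≤ δ := by
  -- The weights of the random colors that are not seen by `e` are made independent of `x`.
  let mixed : (∀ j, Ω j) → Finset J → K → ℝ := fun x f =>
    if f ∈ e.powerset then M.kernel x f else M.law f
  let L : (Finset J → K) → ℝ := fun a => ∏ f ∈ e.powersetᶜ, M.law f (a f)
  have hL : ∀ a, 0 ≤ L a := fun a => Finset.prod_nonneg fun f _ => (M.law_mem f _).1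
  have hmixed : ∀ x, IsProb (Ω := fun _ => K) (mixed x) := by
    intro x
    refine ⟨fun f b => ?_, fun f => ?_⟩ <;> by_cases hf : f ∈ e.powerset
    · simp only [mixed, if_pos hf]; exact (M.kernel_mem x f b).1
    · simp only [mixed, if_neg hf]; exact (M.law_mem f b).1
    · simp only [mixed, if_pos hf]; exact (M.isProb_kernel x).sum_eq_one f
    · simp only [mixed, if_neg hf]; exact M.isProb_law.sum_eq_one f
  have hagree : ∀ x, ∀ f ∈ e.powerset, M.kernel x f = mixed x f := by
    intro x f hf
    simp only [mixed, if_pos hf]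
  have hprod : ∀ x (a : Finset J → K), ∏ f, mixed x f (a f) = M.likelihood e a x * L a := by
    intro x a
    rw [← Finset.prod_mul_prod_compl e.powerset]
    congr 1
    · exact Finset.prod_congr rfl fun f hf => by rw [hagree x f hf]
    · exact Finset.prod_congr rfl fun f hf => by simp only [mixed, if_neg (Finset.mem_compl.1 hf)]
  have hexp : ∀ G : (∀ j, Ω j) → (Finset J → K) → ℝ,
      (∀ x, DependsOn (G x) (e.powerset : Set (Finset J))) →
      (expect w fun x => expect (Ω := fun _ => K) (M.kernel x) (G x)) =
        ∑ a, L a * expect w fun x => M.likelihood e a x * G x a := by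
    intro G hG
    have h1 : ∀ x, expect (Ω := fun _ => K) (M.kernel x) (G x) =
        ∑ a, L a * (M.likelihood e a x * G x a) := by
      intro x
      rw [expect_congr_weight (M.isProb_kernel x) (hmixed x) (hagree x) (hG x)]
      simp only [expect]
      exact Finset.sum_congr rfl fun a _ => by rw [hprod]; ring
    simp only [h1]
    rw [expect_finset_sum]
    exact Finset.sum_congr rfl fun a _ => expect_const_mul _
  have herr : (expect w fun x => expect (Ω := fun _ => K) (M.kernel x) (M.decodeError e x)) ≤ δ :=
    M.error_le e he
  rw [hexp _ M.dependsOn_decodeError] at herr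
  refine le_trans ?_ herr
  rw [hexp, Finset.mul_sum]
  · refine Finset.sum_le_sum fun a _ => ?_
    rw [expect_mul_const]
    have h0 : 0 ≤ expect w fun x => M.likelihood e a x * M.decodeError e x a :=
      expect_nonneg hw fun x =>
        mul_nonneg (M.prod_kernel_mem x _ a).1 (M.decodeError_mem x a).1
    have hcomm : (fun x => M.likelihood e a x * M.decodeError e x a) =
        fun x => M.decodeError e x a * M.likelihood e a x := funext fun x => mul_comm _ _
    split_ifs with h
    · rw [hcomm]
      have := mul_le_mul_of_nonneg_left h.le (hL a)
      calc _ = L a * (θ * expect w (M.likelihood e a)) := by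
            change θ * (L a * (expect w (M.likelihood e a) * 1)) = _
            ring
        _ ≤ _ := this
    · simpa using mul_nonneg (hL a) h0
  · intro x a b hab
    have h1 : ∀ x, M.decodeError e x a = M.decodeError e x b := fun x => M.dependsOn_decodeError x hab
    have h2 : M.likelihood e a = M.likelihood e b := M.dependsOn_likelihood hab
    simp only [h1, h2]

/-- Few edges are bad. -/
theorem RandomModel.expect_badProb_le (hw : IsProb w) (he : e.card ≤ k) (hκ : 0 ≤ κ) (hη : 0 ≤ η)
    (hθ : 0 < θ) :
    expect w (M.badProb κ θ e) ≤
      δ + 2 ^ Fintype.card J * (Fintype.card K * (κ + η)) + δ / θ := by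
  classical
  have hpt : ∀ x (a : Finset J → K),
      (if M.decode e a ≠ c e x ∨ M.IsAtypical κ θ e a then (1 : ℝ) else 0) ≤
      M.decodeError e x a + (∑ f ∈ e.powerset, if M.law f (a f) < κ then (1 : ℝ) else 0) +
        if θ * expect w (M.likelihood e a) <
          expect w fun x => M.decodeError e x a * M.likelihood e a x then 1 else 0 := by
    intro x a
    have h1 := (M.decodeError_mem (e := e) x a).1
    have hnn : ∀ f ∈ e.powerset, (0 : ℝ) ≤ if M.law f (a f) < κ then (1 : ℝ) else 0 :=
      fun f _ => by split_ifs <;> simp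
    have h2 := Finset.sum_nonneg hnn
    have h3 : (0 : ℝ) ≤ if θ * expect w (M.likelihood e a) <
          expect w fun x => M.decodeError e x a * M.likelihood e a x then 1 else 0 := by
      split_ifs <;> simp
    by_cases h : M.decode e a ≠ c e x ∨ M.IsAtypical κ θ e a
    · rw [if_pos h]
      rcases h with h | ⟨f, hf, hlt⟩ | h
      · have : M.decodeError e x a = 1 := if_neg h
        linarith
      · have := Finset.single_le_sum hnn hf
        rw [if_pos hlt] at this
        linarith
      · rw [if_pos h]
        linarith
    · rw [if_neg h]
      linarith
  have hx : ∀ x, M.badProb κ θ e x ≤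
      expect (Ω := fun _ => K) (M.kernel x) (M.decodeError e x) +
      (∑ f ∈ e.powerset, ∑ b, M.kernel x f b * if M.law f b < κ then (1 : ℝ) else 0) +
      expect (Ω := fun _ => K) (M.kernel x) fun a => if θ * expect w (M.likelihood e a) <
          expect w fun x => M.decodeError e x a * M.likelihood e a x then 1 else 0 := by
    intro x
    refine (expect_mono (M.isProb_kernel x) (hpt x)).trans_eq ?_
    rw [expect_add, expect_add, expect_finset_sum]
    congr 2
    exact Finset.sum_congr rfl fun f _ =>
      expect_eval (M.isProb_kernel x) f fun b => if M.law f b < κ then (1 : ℝ) else 0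
  refine (expect_mono hw hx).trans ?_
  rw [expect_add, expect_add, expect_finset_sum]
  have h1 : (expect w fun x => expect (Ω := fun _ => K) (M.kernel x) (M.decodeError e x)) ≤ δ :=
    M.error_le e he
  have h2 : ∀ f ∈ e.powerset, (expect w fun x => ∑ b, M.kernel x f b *
      if M.law f b < κ then (1 : ℝ) else 0) ≤ Fintype.card K * (κ + η) := by
    intro f _
    rw [expect_finset_sum]
    have : ∀ b ∈ Finset.univ, (expect w fun x => M.kernel x f b *
        if M.law f b < κ then (1 : ℝ) else 0) ≤ κ + η := by
      intro b _
      rw [expect_mul_const]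
      have := (abs_le.1 (M.abs_expect_kernel_sub_law_le hw f b)).2
      split_ifs with h
      · linarith
      · rw [mul_zero]; positivity
    refine (Finset.sum_le_sum this).trans_eq ?_
    rw [Finset.sum_const, nsmul_eq_mul, Finset.card_univ]
  have h3 := M.mul_expect_decodeError_gt_le (θ := θ) hw he
  rw [mul_comm, ← le_div_iff₀ hθ] at h3
  have h4 := Finset.sum_le_sum h2
  rw [Finset.sum_const, nsmul_eq_mul] at h4
  have h5 : (e.powerset.card : ℝ) ≤ 2 ^ Fintype.card J := by
    rw [Finset.card_powerset]
    push_cast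
    exact pow_le_pow_right₀ one_le_two (Finset.card_le_univ e)
  have h6 := mul_le_mul_of_nonneg_right h5
    (show 0 ≤ Fintype.card K * (κ + η) by positivity)
  linarith

/-- If the random colors `a` are typical on the edges in `𝓖`, then with positive probability the
colors of all these edges are those that `a` decodes to. -/
theorem RandomModel.le_expect_of_not_isAtypical (hw : IsProb w)
    (hc : ∀ e, DependsOn (c e) (e : Set J)) {N : ℝ} (hN : N = 2 ^ Fintype.card J)
    (hκ : 0 ≤ κ) (hκ1 : κ ≤ 1) (hη : η = κ ^ (2 ^ Fintype.card J) / (16 * N ^ 2))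
    {𝓖 : Finset (Finset J)} (h𝓖 : 𝓖.Nonempty) (a : Finset J → K)
    (ha : ∀ e ∈ 𝓖, ¬ M.IsAtypical κ (1 / (4 * N)) e a) :
    κ ^ (2 ^ Fintype.card J) / 2 ≤
      expect w fun x => ∏ e ∈ 𝓖, (1 - M.decodeError e x a) := by
  have hN1 : 1 ≤ N := by rw [hN]; exact one_le_pow₀ one_le_two
  have hη0 : 0 ≤ η := by rw [hη]; positivity
  let s : Finset (Finset J) := 𝓖.biUnion Finset.powerset
  have hcard : ∀ t : Finset (Finset J), (t.card : ℝ) ≤ N := by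
    intro t
    rw [hN]
    have := Finset.card_le_univ t
    rw [Fintype.card_finset] at this
    exact_mod_cast this
  have hs : ∅ ∈ s := by
    obtain ⟨e, he⟩ := h𝓖
    exact Finset.mem_biUnion.2 ⟨e, he, Finset.empty_mem_powerset e⟩
  have hlaw : ∀ f ∈ s, κ ≤ M.law f (a f) := by
    intro f hf
    obtain ⟨e, he, hfe⟩ := Finset.mem_biUnion.1 hf
    by_contra! h
    exact ha e he (Or.inl ⟨f, hfe, h⟩)
  let Z : (∀ j, Ω j) → ℝ := fun x => ∏ f ∈ s, M.kernel x f (a f)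
  have hZ : κ ^ (2 ^ Fintype.card J) ≤ expect w Z + N * η := by
    calc κ ^ (2 ^ Fintype.card J) ≤ κ ^ s.card := by
          refine pow_le_pow_of_le_one hκ hκ1 ?_
          rw [← Fintype.card_finset]
          exact Finset.card_le_univ s
      _ = ∏ f ∈ s, κ := by simp
      _ ≤ ∏ f ∈ s, M.law f (a f) := Finset.prod_le_prod (fun _ _ => hκ) hlaw
      _ ≤ expect w Z + s.card * η := M.prod_law_le_expect hw a s hs
      _ ≤ expect w Z + N * η := by gcongr; exact hcard s
  -- By the counting lemma, decoding errors at `e` are still rare after conditioning on the random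
  -- colors outside `e`.
  have hD : ∀ e ∈ 𝓖, (expect w fun x => M.decodeError e x a * Z x) ≤
      1 / (4 * N) * expect w Z + 2 * (N * η) := by
    intro e he
    have hsub : e.powerset ⊆ s := Finset.subset_biUnion_of_mem Finset.powerset he
    set t := s \ e.powerset with ht
    have hte : ∀ f ∈ t, ¬ f ⊆ e := fun f hf h =>
      (Finset.mem_sdiff.1 hf).2 (Finset.mem_powerset.2 h)
    have hsplit : ∀ x, Z x = M.likelihood e a x * ∏ f ∈ t, M.kernel x f (a f) := fun x => by
      rw [mul_comm]
      exact (Finset.prod_sdiff hsub).symm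
    have hl01 : ∀ x, 0 ≤ M.likelihood e a x ∧ M.likelihood e a x ≤ 1 :=
      fun x => M.prod_kernel_mem x _ a
    have hld : DependsOn (M.likelihood e a) (e : Set J) := M.dependsOn_prod_kernel e a
    have h1 := M.abs_expect_mul_prod_kernel_sub_le hl01 hld a t hte
    have h2 := M.abs_expect_mul_prod_kernel_sub_le
      (F := fun x => M.decodeError e x a * M.likelihood e a x) (e := e)
      (fun x => ⟨mul_nonneg (M.decodeError_mem x a).1 (hl01 x).1,
        mul_le_one₀ (M.decodeError_mem x a).2 (hl01 x).1 (hl01 x).2⟩)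
      (fun x y hxy => by
        have h1 : c e x = c e y := hc e hxy
        have h2 := hld hxy
        simp only [decodeError, h1, h2]) a t hte
    simp only [mul_assoc, ← hsplit] at h1 h2
    have h3 : (expect w fun x => M.decodeError e x a * M.likelihood e a x) ≤
        1 / (4 * N) * expect w (M.likelihood e a) := by
      by_contra! h
      exact ha e he (Or.inr h)
    have hQ0 : 0 ≤ ∏ f ∈ t, M.law f (a f) := Finset.prod_nonneg fun f _ => (M.law_mem f _).1
    have h4 := mul_le_mul_of_nonneg_right h3 hQ0
    have h5 : (t.card : ℝ) * η ≤ N * η := mul_le_mul_of_nonneg_right (hcard t) hη0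
    have h6 := (abs_le.1 h1).1
    have h7 := (abs_le.1 h2).2
    have h8 : 1 / (4 * N) ≤ 1 := by
      rw [div_le_one (by positivity)]; linarith
    have h9 : 0 ≤ 1 / (4 * N) := by positivity
    have hNη : 0 ≤ N * η := by positivity
    have h10 : 1 / (4 * N) * (expect w (M.likelihood e a) * ∏ f ∈ t, M.law f (a f)) ≤
        1 / (4 * N) * (expect w Z + N * η) := by
      refine mul_le_mul_of_nonneg_left ?_ h9
      linarith
    nlinarith
  have hpt : ∀ x, Z x - ∑ e ∈ 𝓖, M.decodeError e x a * Z x ≤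
      ∏ e ∈ 𝓖, (1 - M.decodeError e x a) := by
    intro x
    have hZ01 : 0 ≤ Z x ∧ Z x ≤ 1 := M.prod_kernel_mem x s a
    have h1 := abs_prod_sub_prod_le 𝓖 (u := fun _ => (1 : ℝ))
      (v := fun e => 1 - M.decodeError e x a) (by simp)
      fun e _ => by
        have := M.decodeError_mem (e := e) x a
        constructor <;> linarith
    have h2 : ∑ e ∈ 𝓖, |1 - (1 - M.decodeError e x a)| = ∑ e ∈ 𝓖, M.decodeError e x a :=
      Finset.sum_congr rfl fun e _ => by
        rw [sub_sub_cancel, abs_of_nonneg (M.decodeError_mem x a).1]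
    rw [h2, Finset.prod_const_one] at h1
    have h3 := (abs_le.1 h1).2
    have h4 : 0 ≤ ∏ e ∈ 𝓖, (1 - M.decodeError e x a) :=
      Finset.prod_nonneg fun e _ => by linarith [(M.decodeError_mem (e := e) x a).2]
    rw [← Finset.sum_mul]
    nlinarith
  refine le_trans ?_ (expect_mono hw hpt)
  rw [expect_sub, expect_finset_sum]
  have h1 := Finset.sum_le_sum hD
  rw [Finset.sum_const, nsmul_eq_mul] at h1
  have hEZ : 0 ≤ expect w Z := expect_nonneg hw fun x => (M.prod_kernel_mem x s a).1
  have h2 : (𝓖.card : ℝ) * (1 / (4 * N) * expect w Z + 2 * (N * η)) ≤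
      N * (1 / (4 * N) * expect w Z + 2 * (N * η)) :=
    mul_le_mul_of_nonneg_right (hcard 𝓖) (by positivity)
  have h3 : N * (1 / (4 * N) * expect w Z + 2 * (N * η)) = expect w Z / 4 + 2 * (N ^ 2 * η) := by
    field_simp
  have h4 : N ^ 2 * η = κ ^ (2 ^ Fintype.card J) / 16 := by
    rw [hη]; field_simp
  have h5 : N * η ≤ N ^ 2 * η := by
    refine mul_le_mul_of_nonneg_right ?_ hη0
    nlinarith
  have h6 : 0 ≤ κ ^ (2 ^ Fintype.card J) := by positivity
  change _ ≤ expect w Z - _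
  linarith

end Bad

/-! ### Removal -/

/-- The probability of an event. -/
noncomputable def prob {J : Type*} [Fintype J] [DecidableEq J] {Ω : J → Type*}
    [∀ j, Fintype (Ω j)] (w : ∀ j, Ω j → ℝ) (S : Set (∀ j, Ω j)) : ℝ :=
  expect w (S.indicator fun _ => 1)

open Classical in
/-- The removal lemma for families of events that depend on prescribed sets of coordinates. -/
theorem exists_removal (n : ℕ) {ε : ℝ} (hε : 0 < ε) :
    ∃ p : ℝ, 0 < p ∧ ∀ (J : Type u) [Fintype J] [DecidableEq J], Fintype.card J = n →
      ∀ (Ω : J → Type v) [∀ j, Fintype (Ω j)] (w : ∀ j, Ω j → ℝ), IsProb w →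
      ∀ (𝓖 : Finset (Finset J)) (A : Finset J → Set (∀ j, Ω j)),
        (∀ e, DependsOn (fun x => x ∈ A e) (e : Set J)) →
      p ≤ prob w {x | ∀ e ∈ 𝓖, x ∈ A e} ∨
      ∃ R : Finset J → Set (∀ j, Ω j), (∀ e, DependsOn (fun x => x ∈ R e) (e : Set J)) ∧
        (∀ e, prob w (R e) ≤ ε) ∧ ∀ x, ∃ e ∈ 𝓖, x ∉ A e ∨ x ∈ R e := by
  set N : ℝ := 2 ^ n with hN
  have hN1 : 1 ≤ N := by rw [hN]; exact one_le_pow₀ one_le_two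
  have hε₁ : 0 < min ε 1 := lt_min hε one_pos
  -- With `t` random colors, those of law below `κ t` are negligible even in total, and the
  -- uniformity error `η t` is negligible compared with a product of `2 ^ n` laws above `κ t`.
  let κ : ℕ → ℝ := fun t => min ε 1 / (16 * N ^ 2 * (t + 1))
  have hκ0 : ∀ t, 0 < κ t := fun t => by positivity
  have hκ1 : ∀ t, κ t ≤ 1 := by
    intro t
    rw [div_le_one (by positivity)]
    refine (min_le_right _ _).trans ?_
    have : (0 : ℝ) ≤ t := Nat.cast_nonneg t
    nlinarith [sq_nonneg N]
  let η : ℕ → ℝ := fun t => κ t ^ (2 ^ n) / (16 * N ^ 2)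
  have hη0 : ∀ t, 0 < η t := fun t => by have := hκ0 t; positivity
  have hηκ : ∀ t, η t ≤ κ t := by
    intro t
    have h1 : κ t ^ (2 ^ n) ≤ κ t := pow_le_of_le_one (hκ0 t).le (hκ1 t) (by positivity)
    have h2 : η t ≤ κ t ^ (2 ^ n) := div_le_self (by have := hκ0 t; positivity) (by nlinarith)
    exact h2.trans h1
  have hδ : 0 < ε / (20 * N ^ 2) := by positivity
  obtain ⟨M, hM⟩ := exists_randomModel.{u, v} n n Bool _ hδ η hη0
  refine ⟨κ M ^ (2 ^ n) / 2, by have := hκ0 M; positivity, ?_⟩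
  intro J _ _ hJ Ω _ w hw 𝓖 A hA
  rcases 𝓖.eq_empty_or_nonempty with rfl | h𝓖
  · left
    have : κ M ^ (2 ^ n) ≤ 1 := pow_le_one₀ (hκ0 M).le (hκ1 M)
    simp only [prob, Finset.notMem_empty, false_imp_iff, implies_true, Set.ofPred_true,
      Set.indicator_univ, expect_one hw]
    linarith
  have hc : ∀ e, DependsOn (fun x => decide (x ∈ A e)) (e : Set J) := by
    intro e x y hxy
    simp only [hA e hxy]
  obtain ⟨K, _, hKM, ⟨R⟩⟩ := hM J hJ Ω w hw (fun e x => decide (x ∈ A e)) hc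
  set t := Fintype.card K with ht
  let bad : Finset J → (∀ j, Ω j) → ℝ := fun e => R.badProb (κ t) (1 / (4 * N)) e
  by_cases hex : ∃ x, ∀ e ∈ 𝓖, x ∈ A e ∧ bad e x ≤ 1 / (2 * N)
  · left
    obtain ⟨x, hx⟩ := hex
    have hcard : (𝓖.card : ℝ) ≤ N := by
      have := Finset.card_le_univ 𝓖
      rw [Fintype.card_finset, hJ] at this
      rw [hN]
      exact_mod_cast this
    -- By the union bound, some random colors are not bad for any edge of the surviving point.
    obtain ⟨a, ha⟩ : ∃ a : Finset J → K, ∀ e ∈ 𝓖, ¬ (R.decode e a ≠ decide (x ∈ A e) ∨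
        R.IsAtypical (κ t) (1 / (4 * N)) e a) := by
      by_contra! hall
      have h1 : expect (Ω := fun _ => K) (R.kernel x) (fun _ => 1) ≤ ∑ e ∈ 𝓖, bad e x := by
        simp only [bad, RandomModel.badProb]
        rw [← expect_finset_sum]
        refine expect_mono (R.isProb_kernel x) fun a => ?_
        obtain ⟨e, he, hbad⟩ := hall a
        have := Finset.single_le_sum (f := fun e => if R.decode e a ≠ decide (x ∈ A e) ∨
          R.IsAtypical (κ t) (1 / (4 * N)) e a then (1 : ℝ) else 0)
          (fun e _ => by split_ifs <;> simp) he
        simpa only [if_pos hbad] using this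
      rw [expect_one (R.isProb_kernel x)] at h1
      have h2 := Finset.sum_le_sum fun e he => (hx e he).2
      rw [Finset.sum_const, nsmul_eq_mul] at h2
      have h3 : (𝓖.card : ℝ) * (1 / (2 * N)) ≤ 1 / 2 := by
        rw [mul_one_div, div_le_div_iff₀ (by positivity) (by positivity)]
        linarith
      linarith
    have hcount := R.le_expect_of_not_isAtypical (κ := κ t) hw hc (N := N) (by rw [hJ]) (hκ0 t).le
      (hκ1 t) (by rw [hJ]) h𝓖 a fun e he h => ha e he (Or.inr h)
    rw [hJ] at hcount
    have hmono : κ M ^ (2 ^ n) ≤ κ t ^ (2 ^ n) := by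
      refine pow_le_pow_left₀ (hκ0 M).le ?_ _
      have : (t : ℝ) ≤ M := by exact_mod_cast hKM
      simp only [κ]
      gcongr
    refine le_trans (by linarith) (hcount.trans (expect_mono hw fun y => ?_))
    by_cases hy : ∀ e ∈ 𝓖, y ∈ A e
    · rw [Set.indicator_of_mem (show y ∈ {x | ∀ e ∈ 𝓖, x ∈ A e} from hy)]
      refine Finset.prod_le_one (fun e _ => ?_) fun e _ => ?_
      · linarith [(R.decodeError_mem (e := e) y a).2]
      · linarith [(R.decodeError_mem (e := e) y a).1]
    · rw [Set.indicator_of_notMem (show y ∉ {x | ∀ e ∈ 𝓖, x ∈ A e} from hy)]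
      push Not at hy
      obtain ⟨e, he, hye⟩ := hy
      refine (Finset.prod_eq_zero he ?_).le
      have h1 : R.decode e a = true := by
        have := ha e he
        simp only [ne_eq, not_or, not_not] at this
        rw [this.1]
        exact decide_eq_true (hx e he).1
      simp [RandomModel.decodeError, h1, hye]
  · right
    refine ⟨fun e => {x | 1 / (2 * N) < bad e x}, fun e x y hxy => ?_, fun e => ?_, fun x => ?_⟩
    · have : bad e x = bad e y := R.dependsOn_badProb (hc e) hxy
      simp only [Set.mem_ofPred_eq, this]
    · have hbad := R.expect_badProb_le (κ := κ t) (θ := 1 / (4 * N)) (e := e) hw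
        (hJ ▸ Finset.card_le_univ e) (hκ0 t).le (hη0 t).le (by positivity)
      rw [hJ, ← hN, ← ht] at hbad
      have hmarkov : prob w {x | 1 / (2 * N) < bad e x} ≤ 2 * N * expect w (bad e) := by
        rw [prob, ← expect_const_mul]
        refine expect_mono hw fun x => ?_
        have h0 : 0 ≤ bad e x := expect_nonneg (R.isProb_kernel x) fun a => by split_ifs <;> simp
        by_cases hx : 1 / (2 * N) < bad e x
        · rw [Set.indicator_of_mem (show x ∈ {x | 1 / (2 * N) < bad e x} from hx)]
          rw [div_lt_iff₀ (by positivity)] at hx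
          linarith
        · rw [Set.indicator_of_notMem (show x ∉ {x | 1 / (2 * N) < bad e x} from hx)]
          positivity
      have h1 : (t : ℝ) * (κ t + η t) ≤ ε / (8 * N ^ 2) := by
        have h2 : (t : ℝ) * (κ t + η t) ≤ 2 * ((t + 1) * κ t) := by
          have := hηκ t
          have := hκ0 t
          have : (0 : ℝ) ≤ t := Nat.cast_nonneg t
          nlinarith
        have h3 : 2 * (((t : ℝ) + 1) * κ t) = min ε 1 / (8 * N ^ 2) := by
          simp only [κ]
          field_simp
          norm_num
        rw [h3] at h2
        refine h2.trans ?_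
        gcongr
        exact min_le_left _ _
      have h2 : 2 * N * (N * (t * (κ t + η t))) ≤ ε / 4 := by
        calc 2 * N * (N * (t * (κ t + η t))) ≤ 2 * N * (N * (ε / (8 * N ^ 2))) := by gcongr
          _ = ε / 4 := by field_simp; norm_num
      have h3 : 2 * N * (ε / (20 * N ^ 2) + ε / (20 * N ^ 2) / (1 / (4 * N))) ≤ ε / 2 := by
        have : 2 * N * (ε / (20 * N ^ 2) + ε / (20 * N ^ 2) / (1 / (4 * N))) =
            ε / 10 * (1 / N) + ε * (2 / 5) := by
          field_simp
          ring
        rw [this]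
        have h4 : 1 / N ≤ 1 := by rw [div_le_one (by positivity)]; exact hN1
        nlinarith
      have h4 := mul_le_mul_of_nonneg_left hbad (show 0 ≤ 2 * N by positivity)
      refine hmarkov.trans (h4.trans ?_)
      linarith
    · push Not at hex
      obtain ⟨e, he, h⟩ := hex x
      refine ⟨e, he, ?_⟩
      by_cases hx : x ∈ A e
      · exact Or.inr (h hx)
      · exact Or.inl hx

/-! ### Transfer to partite hypergraphs -/

section Transfer

open PartiteHypergraph

variable {ι : Type*} {W Ω : ι → Type*}

/-- A point of the product over all vertices of the pattern is a partitionwise map. -/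
def toMap (x : ∀ j : Σ i, W i, Ω j.1) : PartitionwiseMap W Ω :=
  fun i v => x ⟨i, v⟩

open Classical in
/-- The set of vertices of an edge. -/
noncomputable def vertices {I : Finset ι} (e : Edge W I) : Finset (Σ i, W i) :=
  Finset.univ.image fun i : {i // i ∈ I} => ⟨i, e i⟩

theorem mapEdge_toMap_congr {I : Finset ι} (e : Edge W I) {x y : ∀ j : Σ i, W i, Ω j.1}
    (h : ∀ j ∈ vertices e, x j = y j) : mapEdge (toMap x) e = mapEdge (toMap y) e := by
  classical
  funext i
  exact h ⟨i, e i⟩ (Finset.mem_image_of_mem _ (Finset.mem_univ i))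

theorem eq_of_mapEdge_toMap_eq {I : Finset ι} (e : Edge W I) {x y : ∀ j : Σ i, W i, Ω j.1}
    (h : mapEdge (toMap x) e = mapEdge (toMap y) e) : ∀ j ∈ vertices e, x j = y j := by
  classical
  intro j hj
  obtain ⟨i, -, rfl⟩ := Finset.mem_image.1 hj
  exact congrFun h i

variable [Fintype ι] [∀ i, Fintype (W i)] [∀ i, MeasurableSpace (Ω i)]
  (μ : ∀ i, Measure (Ω i)) [∀ i, IsProbabilityMeasure (μ i)]

/-- The image of a fixed edge under a random partitionwise map is a random edge. -/
theorem map_mapEdge_mapLaw {I : Finset ι} (e : Edge W I) :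
    (mapLaw μ W).map (fun φ => mapEdge φ e) = edgeLaw μ I := by
  classical
  refine (Measure.pi_eq fun s hs => ?_).symm
  have hmeas : Measurable fun φ : PartitionwiseMap W Ω => mapEdge φ e :=
    measurable_pi_lambda _ fun i => (measurable_pi_apply (e i)).comp (measurable_pi_apply i.1)
  rw [Measure.map_apply hmeas (MeasurableSet.univ_pi hs)]
  let t : ∀ i, W i → Set (Ω i) := fun i v =>
    if h : ∃ hi : i ∈ I, e ⟨i, hi⟩ = v then s ⟨i, h.1⟩ else Set.univ
  have hpre : (fun φ : PartitionwiseMap W Ω => mapEdge φ e) ⁻¹' Set.univ.pi s =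
      Set.univ.pi fun i => Set.univ.pi (t i) := by
    ext φ
    simp only [Set.mem_preimage, Set.mem_univ_pi]
    constructor
    · intro h i v
      by_cases hv : ∃ hi : i ∈ I, e ⟨i, hi⟩ = v
      · obtain ⟨hi, rfl⟩ := hv
        simpa [t, hi, mapEdge] using h ⟨i, hi⟩
      · simp [t, hv]
    · intro h i
      have := h i.1 (e i)
      simpa [t, mapEdge] using this
  rw [hpre, mapLaw, Measure.pi_pi]
  simp only [Measure.pi_pi]
  have h1 : ∀ i, ∏ v, μ i (t i v) = if hi : i ∈ I then μ i (s ⟨i, hi⟩) else 1 := by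
    intro i
    split_ifs with hi
    · rw [Finset.prod_eq_single (e ⟨i, hi⟩)]
      · simp [t, hi]
      · intro v _ hv
        have : ¬ ∃ hi : i ∈ I, e ⟨i, hi⟩ = v := fun ⟨_, h⟩ => hv h.symm
        simp [t, this]
      · simp
    · refine Finset.prod_eq_one fun v _ => ?_
      have : ¬ ∃ hi : i ∈ I, e ⟨i, hi⟩ = v := fun ⟨h, _⟩ => hi h
      simp [t, this]
  simp only [h1]
  rw [← Finset.prod_subset (Finset.subset_univ I) fun i _ hi => dif_neg hi,
    ← Finset.prod_coe_sort]
  exact Finset.prod_congr rfl fun i _ => dif_pos i.2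

omit [Fintype ι] [∀ i, Fintype (W i)] in
theorem isProb_real_singleton [∀ i, Fintype (Ω i)] [∀ i, DiscreteMeasurableSpace (Ω i)] :
    IsProb (Ω := fun j : Σ i, W i => Ω j.1) fun j x => (μ j.1).real {x} := by
  refine ⟨fun j x => measureReal_nonneg, fun j => ?_⟩
  rw [sum_measureReal_singleton]
  simp

instance isProbabilityMeasure_mapLaw : IsProbabilityMeasure (mapLaw μ W) := by
  unfold mapLaw
  infer_instance

omit [Fintype ι] in
instance isProbabilityMeasure_edgeLaw (I : Finset ι) : IsProbabilityMeasure (edgeLaw μ I) := by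
  unfold edgeLaw
  infer_instance

theorem mapLaw_real_eq_prob [∀ i, Fintype (Ω i)] [∀ i, DiscreteMeasurableSpace (Ω i)]
    [DecidableEq (Σ i, W i)] (S : Set (PartitionwiseMap W Ω)) :
    (mapLaw μ W).real S =
      prob (Ω := fun j : Σ i, W i => Ω j.1) (fun j x => (μ j.1).real {x}) (toMap ⁻¹' S) := by
  classical
  have hsing : ∀ φ : PartitionwiseMap W Ω,
      (mapLaw μ W).real {φ} = ∏ i, ∏ v, (μ i).real {φ i v} := by
    intro φ
    simp only [mapLaw, measureReal_def, Measure.pi_singleton, ENNReal.toReal_prod]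
  have h1 : (mapLaw μ W).real S = ∑ φ : PartitionwiseMap W Ω,
      (∏ i, ∏ v, (μ i).real {φ i v}) * S.indicator (fun _ => 1) φ := by
    have hS : S = ((Finset.univ.filter fun φ => φ ∈ S : Finset (PartitionwiseMap W Ω)) :
        Set (PartitionwiseMap W Ω)) := by ext; simp
    conv_lhs => rw [hS, ← sum_measureReal_singleton]
    rw [Finset.sum_filter]
    refine Finset.sum_congr rfl fun φ _ => ?_
    rw [hsing]
    by_cases hφ : φ ∈ S <;> simp [hφ]
  rw [h1, prob, expect]
  rw [← Equiv.sum_comp (Equiv.piCurry fun i (_ : W i) => Ω i)]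
  refine Finset.sum_congr rfl fun x _ => ?_
  rw [Fintype.prod_sigma]
  rfl

end Transfer

end HypergraphRemoval

open HypergraphRemoval in
theorem mainTheorem4 (r k h : ℕ) (hk : 1 ≤ k) (hkr : k ≤ r) (b : ℕ → ℕ) (ε : ℝ) (hε : 0 < ε) :
    ∃ c : ℝ, 0 < c ∧
      ∀ (ι : Type*) [Fintype ι], Fintype.card ι = r →
      -- the finite probability spaces
      ∀ (Ω : ι → Type*) [∀ i, Finite (Ω i)] [∀ i, MeasurableSpace (Ω i)]
        [∀ i, DiscreteMeasurableSpace (Ω i)]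
        (μ : ∀ i, Measure (Ω i)) [∀ i, IsProbabilityMeasure (μ i)],
      -- the large hypergraph
      ∀ (C : PartiteHypergraph.Index ι k → Type*) [∀ I, Fintype (C I)],
        PartiteHypergraph.IsColorCount b C →
      ∀ G : PartiteHypergraph.ColoredHypergraph k Ω C,
      -- the pattern
      ∀ (W : ι → Type*) [∀ i, Fintype (W i)], (∀ i, Fintype.card (W i) = h) →
      ∀ (D : PartiteHypergraph.Index ι k → Type*) [∀ I, Fintype (D I)]
        (F : PartiteHypergraph.UniformHypergraph k (b k - 1) W D)
        (σ : ∀ I, F.VisibleColor I ↪ C I),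
      (∃ G' : PartiteHypergraph.ColoredHypergraph k Ω C,
        (∀ I : PartiteHypergraph.Index ι k, I.1.card = k →
          (PartiteHypergraph.edgeLaw μ I.1).real {e | G'.color I e ≠ G.color I e} ≤ ε) ∧
        (PartiteHypergraph.mapLaw μ W).real (PartiteHypergraph.copies F σ G') = 0) ∨
      c ≤ (PartiteHypergraph.mapLaw μ W).real (PartiteHypergraph.copies F σ G) := by
  classical
  -- An index set of size `k` carries `h ^ k` edges of the pattern.
  have hε' : 0 < ε / (h ^ k + 1) := by positivity
  obtain ⟨c, hc, hremoval⟩ := exists_removal (r * h) hε'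
  refine ⟨c, hc, ?_⟩
  intro ι _ hι Ω _ _ _ μ _ C _ hC G W _ hW D _ F σ
  have : ∀ i, Fintype (Ω i) := fun i => Fintype.ofFinite _
  have hΩ : ∀ i, Nonempty (Ω i) := fun i => nonempty_of_isProbabilityMeasure (μ i)
  let w : ∀ j : Σ i, W i, Ω j.1 → ℝ := fun j x => (μ j.1).real {x}
  have hJ : Fintype.card (Σ i, W i) = r * h := by
    simp [Fintype.card_sigma, hW, hι]
  -- The event that all the pattern edges with vertex set `g` are mapped to edges of their color.
  let A : Finset (Σ i, W i) → Set (∀ j : Σ i, W i, Ω j.1) := fun g =>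
    {x | ∀ (I : PartiteHypergraph.Index ι k) (e : PartiteHypergraph.Edge W I.1)
      (he : F.color I e ∉ F.invisible I), vertices e = g →
      G.color I (PartiteHypergraph.mapEdge (toMap x) e) = σ I ⟨F.color I e, he⟩}
  have hA : ∀ g, DependsOn (fun x => x ∈ A g) (g : Set (Σ i, W i)) := by
    intro g x y hxy
    refine propext (forall_congr' fun I => forall_congr' fun e => forall_congr' fun he =>
      forall_congr' fun hg => ?_)
    subst hg
    rw [mapEdge_toMap_congr e hxy]
  let 𝓖 : Finset (Finset (Σ i, W i)) := Finset.univ.filter fun g =>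
    ∃ (I : PartiteHypergraph.Index ι k) (e : PartiteHypergraph.Edge W I.1),
      F.color I e ∉ F.invisible I ∧ vertices e = g
  rcases hremoval (Σ i, W i) hJ (fun j => Ω j.1) w (isProb_real_singleton μ) 𝓖 A hA with
    hmany | ⟨R, hRd, hR, hRA⟩
  · right
    rw [mapLaw_real_eq_prob]
    refine hmany.trans_eq (congrArg (prob w) ?_)
    ext x
    constructor
    · intro hx I e he
      exact hx (vertices e) (Finset.mem_filter.2 ⟨Finset.mem_univ _, I, e, he, rfl⟩) I e he rfl
    · intro hx g _ I e he _
      exact hx I e he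
  · left
    have hCne : ∀ I, Nonempty (C I) := fun I => ⟨G.color I fun i => (hΩ i).some⟩
    -- The pattern has fewer visible colors than there are colors.
    have hmissing : ∀ I : PartiteHypergraph.Index ι k, I.1.card = k →
        ∃ a : C I, a ∉ Set.range (σ I) := by
      intro I hI
      by_contra! hsurj
      have h1 : Fintype.card (C I) ≤ Fintype.card (F.VisibleColor I) :=
        Fintype.card_le_of_surjective (σ I) hsurj
      have h2 : Fintype.card (F.VisibleColor I) ≤ Fintype.card (D I) := Fintype.card_subtype_le _
      have h3 := F.colorCount I
      have h4 := hC I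
      have h5 : 0 < Fintype.card (C I) :=
        Fintype.card_pos_iff.2 (hCne I)
      simp only [hI, lt_irrefl, if_false] at h3
      rw [hI] at h4
      omega
    choose! a ha using hmissing
    let removed : ∀ I : PartiteHypergraph.Index ι k, PartiteHypergraph.Edge W I.1 →
        Set (PartiteHypergraph.Edge Ω I.1) := fun I e =>
      {y | ∃ x ∈ R (vertices e), PartiteHypergraph.mapEdge (toMap x) e = y}
    let G' : PartiteHypergraph.ColoredHypergraph k Ω C :=
      ⟨fun I y => if I.1.card = k ∧ ∃ e, y ∈ removed I e then a I else G.color I y⟩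
    refine ⟨G', fun I hI => ?_, ?_⟩
    · have hsub : {y | G'.color I y ≠ G.color I y} ⊆ ⋃ e, removed I e := by
        intro y hy
        by_contra hny
        refine hy (if_neg ?_)
        rintro ⟨-, e, he⟩
        exact hny (Set.mem_iUnion.2 ⟨e, he⟩)
      have hone : ∀ e, (PartiteHypergraph.edgeLaw μ I.1).real (removed I e) ≤ ε / (h ^ k + 1) := by
        intro e
        have hmeas : Measurable fun φ : PartiteHypergraph.PartitionwiseMap W Ω =>
            PartiteHypergraph.mapEdge φ e :=
          measurable_pi_lambda _ fun i => (measurable_pi_apply (e i)).comp (measurable_pi_apply i.1)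
        rw [← map_mapEdge_mapLaw μ e, map_measureReal_apply hmeas (Set.toFinite _).measurableSet,
          mapLaw_real_eq_prob]
        refine (hR (vertices e)).trans' (le_of_eq (congrArg (prob w) ?_))
        ext x
        constructor
        · rintro ⟨x', hx', hxx⟩
          have : (x' ∈ R (vertices e)) = (x ∈ R (vertices e)) :=
            hRd _ (eq_of_mapEdge_toMap_eq e hxx)
          exact this ▸ hx'
        · intro hx
          exact ⟨x, hx, rfl⟩
      have hcard : (Fintype.card (PartiteHypergraph.Edge W I.1) : ℝ) = h ^ k := by
        rw [Fintype.card_pi, Finset.prod_congr rfl fun i _ => hW i.1]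
        simp [hI]
      refine (measureReal_mono hsub).trans ((measureReal_iUnion_fintype_le _).trans ?_)
      refine (Finset.sum_le_sum fun e _ => hone e).trans ?_
      rw [Finset.sum_const, nsmul_eq_mul, Finset.card_univ, hcard, mul_div_assoc',
        div_le_iff₀ (by positivity)]
      nlinarith
    · have hempty : PartiteHypergraph.copies F σ G' = ∅ := by
        refine Set.eq_empty_iff_forall_notMem.2 fun φ hφ => ?_
        let x : ∀ j : Σ i, W i, Ω j.1 := fun j => φ j.1 j.2
        -- A visible edge of a copy has not been recolored, since its color is in the range of `σ`.
        have hkeep : ∀ (I : PartiteHypergraph.Index ι k) (e : PartiteHypergraph.Edge W I.1)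
            (he : F.color I e ∉ F.invisible I), x ∉ R (vertices e) ∧
            G.color I (PartiteHypergraph.mapEdge φ e) = σ I ⟨F.color I e, he⟩ := by
          intro I e he
          have hI : I.1.card = k := by
            by_contra hne
            refine he ?_
            rw [F.invisible_of_lt I (lt_of_le_of_ne I.2.2 hne)]
            exact Set.mem_univ _
          have h1 := hφ I e he
          have hnot : ¬ (I.1.card = k ∧ ∃ e', PartiteHypergraph.mapEdge φ e ∈ removed I e') := by
            intro hrem
            have h2 : G'.color I (PartiteHypergraph.mapEdge φ e) = a I := if_pos hrem
            exact ha I hI ⟨_, h1.symm.trans h2⟩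
          refine ⟨fun hxR => hnot ⟨hI, e, x, hxR, rfl⟩, ?_⟩
          have h2 : G'.color I (PartiteHypergraph.mapEdge φ e) =
              G.color I (PartiteHypergraph.mapEdge φ e) := if_neg hnot
          rw [← h2, h1]
        obtain ⟨g, hg, hgx⟩ := hRA x
        obtain ⟨-, I, e, he, rfl⟩ := Finset.mem_filter.1 hg
        rcases hgx with hgx | hgx
        · exact hgx fun I' e' he' _ => (hkeep I' e' he').2
        · exact (hkeep I e he).1 hgx
      rw [hempty]
      simp
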